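/- Let $d\in\mathbb{N}$, let $\varphi\in\mathcal{S}(\mathbb{R}^d)$ be a Schwartz function with $\|\varphi\|_{L^2(\mathbb{R}^d)}=1$, and let $\alpha\in(0,1)$. Let $A^\alpha_\infty(\mathbb{R}^{2d})$ be the set of functions $a\in L^1_{\rm loc}(\mathbb{R}^{2d})$ with $a>0$ almost everywhere such that for every open Euclidean ball $B\subset\mathbb{R}^{2d}$ and every Lebesgue measurable $E\subset B$, $$|E|\ge(1-\alpha)|B|\ \Longrightarrow\ \int_E a\,dx\,d\omega\ \ge\ \alpha\int_B a\,dx\,d\omega .$$ For $h>0$ and $x_0,\omega_0\in\mathbb{R}^d$ let $$\varphi^{h}_{(x_0,\omega_0)}(x)=h^{-d/4}\,e^{\frac{i}{h}\omega_0\cdot x}\,\varphi\big(h^{-1/2}(x-x_0)\big),\qquad x\in\mathbb{R}^d .$$ With $\langle f,g\rangle=\int f\overline g$ the inner product of $L^2(\mathbb{R}^d)$, let $$\mathcal{D}_{a,h}=\Big\{f\in L^2(\mathbb{R}^d):\int_{\mathbb{R}^{2d}}a(x,\omega)\,|\langle f,\varphi^h_{(x,\omega)}\rangle|^2\,dx\,d\omega<\infty\Big\},$$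 $$Q_{a,h}(f,g)=(2\pi h)^{-d}\int_{\mathbb{R}^{2d}}a(x,\omega)\,\langle f,\varphi^h_{(x,\omega)}\rangle\,\overline{\langle g,\varphi^h_{(x,\omega)}\rangle}\,dx\,d\omega,\qquad f,g\in\mathcal{D}_{a,h}.$$ Let $A_{a,h}$ be the operator in $L^2(\mathbb{R}^d)$ associated with this form: $f\in\operatorname{dom}A_{a,h}$ and $A_{a,h}f=u$ if and only if $f\in\mathcal{D}_{a,h}$, $u\in L^2(\mathbb{R}^d)$ and $\langle u,g\rangle=Q_{a,h}(f,g)$ for all $g\in\mathcal{D}_{a,h}$. Let $\sigma(A_{a,h})$ be its spectrum, and let $$\lambda(a,h)=\inf\Big\{\frac1{|B|}\int_B a(x,\omega)\,dx\,d\omega:\ B\subset\mathbb{R}^{2d}\text{ an open ball of radius }h^{1/2}\Big\}.$$ Then there exists a constant $C>0$, depending only on $\alpha$ and $\varphi$ (hence also on $d$), such that for every $a\in A^\alpha_\infty(\mathbb{R}^{2d})$ and every $h>0$: the form domain $\mathcal{D}_{a,h}$ is dense in $L^2(\mathbb{R}^d)$, the operator $A_{a,h}$ is self-adjoint, its spectrum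 is nonempty and bounded below, and $$C^{-1}\lambda(a,h)\ \le\ \inf\sigma(A_{a,h})\ \le\ C\,\lambda(a,h).$$ -/

import Mathlib

open MeasureTheory Complex Metric
open scoped SchwartzMap ComplexConjugate ENNReal

noncomputable section

namespace AntiWick

/-- The configuration space `ℝ^d` with its Euclidean structure. -/
abbrev Conf (d : ℕ) : Type := EuclideanSpace ℝ (Fin d)

/-- The phase space `ℝ^{2d} = ℝ^d × ℝ^d` of points `z = (x, ω)`, with the Euclidean norm
`|z|² = |x|² + |ω|²` and Lebesgue measure. -/
abbrev Phase (d : ℕ) : Type := WithLp 2 (Conf d × Conf d)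

/-- The Hilbert space `L²(ℝ^d)` of complex valued functions. -/
abbrev L2 (d : ℕ) : Type := Lp ℂ 2 (volume : Measure (Conf d))

/-- The Muckenhoupt class `A_∞^α` of a Euclidean space `X` (finite-dimensional, with Lebesgue
measure). -/
structure MuckenhouptAInf {X : Type*} [NormedAddCommGroup X] [MeasureSpace X]
    (α : ℝ) (w : X → ℝ) : Prop where
  locallyIntegrable : LocallyIntegrable w volume
  pos : ∀ᵐ x, 0 < w x
  condition : ∀ (x : X) (r : ℝ), 0 < r → ∀ E : Set X, NullMeasurableSet E volume →
    E ⊆ ball x r → (1 - α) * volume.real (ball x r) ≤ volume.real E →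
      α * ∫ y in ball x r, w y ≤ ∫ y in E, w y

/-- `λ(a,h)`: the infimum of the averages of `a` over the open balls of radius `h^{1/2}`. -/
def lam {d : ℕ} (a : Phase d → ℝ) (h : ℝ) : ℝ :=
  ⨅ z : Phase d, ⨍ y in ball z (h ^ (1 / 2 : ℝ)), a y

variable {d : ℕ}

/-- The coherent state
`φ^h_{(x₀,ω₀)}(x) = h^{-d/4} exp((i/h) ω₀ · x) φ(h^{-1/2} (x - x₀))`, with `z = (x₀, ω₀)`. -/
def coherentState (φ : 𝓢(Conf d, ℂ)) (h : ℝ) (z : Phase d) (x : Conf d) : ℂ :=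
  ((h ^ (-(d : ℝ) / 4) : ℝ) : ℂ) * exp (I / h * (inner ℝ z.snd x : ℝ)) *
    φ (h ^ (-(1 / 2) : ℝ) • (x - z.fst))

lemma continuous_coherentState (φ : 𝓢(Conf d, ℂ)) (h : ℝ) :
    Continuous (fun p : Phase d × Conf d => coherentState φ h p.1 p.2) := by
  unfold coherentState
  have := φ.continuous
  fun_prop

lemma memLp_coherentState (φ : 𝓢(Conf d, ℂ)) {h : ℝ} (hh : 0 < h) (z : Phase d) :
    MemLp (coherentState φ h z) 2 (volume : Measure (Conf d)) := by
  have hcont : Continuous (coherentState φ h z) := by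
    have := φ.continuous
    unfold coherentState
    fun_prop
  have hc : h ^ (-(1 / 2) : ℝ) ≠ 0 := (Real.rpow_pos_of_pos hh _).ne'
  have hφ : Integrable (fun x => ‖φ x‖ ^ 2) (volume : Measure (Conf d)) :=
    (memLp_two_iff_integrable_sq_norm φ.continuous.aestronglyMeasurable).1 (φ.memLp 2 volume)
  refine (memLp_two_iff_integrable_sq_norm hcont.aestronglyMeasurable).2 ?_
  have h1 := ((hφ.comp_smul hc).comp_sub_right z.fst).const_mul
    (‖((h ^ (-(d : ℝ) / 4) : ℝ) : ℂ)‖ ^ 2)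
  have this : (fun x => ‖coherentState φ h z x‖ ^ 2) = fun x =>
      ‖((h ^ (-(d : ℝ) / 4) : ℝ) : ℂ)‖ ^ 2 * ‖φ (h ^ (-(1 / 2) : ℝ) • (x - z.fst))‖ ^ 2 := by
    funext x
    have he : ‖exp (I / h * (inner ℝ z.snd x : ℝ))‖ = 1 := by
      have h2 : I / (h : ℂ) * (inner ℝ z.snd x : ℝ) = ((inner ℝ z.snd x / h : ℝ) : ℂ) * I := by
        push_cast; ring
      rw [h2, norm_exp_ofReal_mul_I]
    simp only [coherentState, norm_mul, he, mul_one, mul_pow]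
  rw [this]
  exact h1

/-- The transform `(x,ω) ↦ ⟨f, φ^h_{(x,ω)}⟩ = ∫ f(y) conj(φ^h_{(x,ω)}(y)) dy`. -/
def transform (φ : 𝓢(Conf d, ℂ)) (h : ℝ) (f : L2 d) (z : Phase d) : ℂ :=
  ∫ y, f y * conj (coherentState φ h z y)

lemma integrable_transform (φ : 𝓢(Conf d, ℂ)) {h : ℝ} (hh : 0 < h) (f : L2 d) (z : Phase d) :
    Integrable (fun y => f y * conj (coherentState φ h z y)) volume := by
  have h1 : MemLp (fun y => conj (coherentState φ h z y)) 2 (volume : Measure (Conf d)) :=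
    (memLp_coherentState φ hh z).star
  exact MemLp.integrable_mul (p := 2) (q := 2) (Lp.memLp f) h1

lemma transform_add (φ : 𝓢(Conf d, ℂ)) {h : ℝ} (hh : 0 < h) (f g : L2 d) :
    transform φ h (f + g) = transform φ h f + transform φ h g := by
  funext z
  simp only [transform, Pi.add_apply]
  rw [← integral_add (integrable_transform φ hh f z) (integrable_transform φ hh g z)]
  refine integral_congr_ae ?_
  filter_upwards [Lp.coeFn_add f g] with y hy
  rw [hy, Pi.add_apply, add_mul]

lemma transform_smul (φ : 𝓢(Conf d, ℂ)) (h : ℝ) (c : ℂ) (f : L2 d) :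
    transform φ h (c • f) = c • transform φ h f := by
  funext z
  simp only [transform, Pi.smul_apply, smul_eq_mul]
  rw [← integral_const_mul]
  refine integral_congr_ae ?_
  filter_upwards [Lp.coeFn_smul c f] with y hy
  rw [hy, Pi.smul_apply, smul_eq_mul, mul_assoc]

lemma transform_zero (φ : 𝓢(Conf d, ℂ)) (h : ℝ) : transform φ h (0 : L2 d) = 0 := by
  simpa using transform_smul φ h 0 (0 : L2 d)

lemma stronglyMeasurable_transform (φ : 𝓢(Conf d, ℂ)) (h : ℝ) (f : L2 d) :
    StronglyMeasurable (transform φ h f) := by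
  refine StronglyMeasurable.integral_prod_right (f := fun z y => f y * conj (coherentState φ h z y)) ?_
  refine StronglyMeasurable.mul ((Lp.stronglyMeasurable f).comp_measurable measurable_snd) ?_
  exact (continuous_conj.comp (continuous_coherentState φ h)).stronglyMeasurable

/-- The measure `a(x,ω) dx dω` on phase space, for a nonnegative symbol `a`. -/
def symbolMeasure (a : Phase d → ℝ) : Measure (Phase d) :=
  volume.withDensity fun z => ENNReal.ofReal (a z)

/-- The form domain
`D_{a,h} = {f ∈ L²(ℝ^d) : ∫ a(x,ω) |⟨f, φ^h_{(x,ω)}⟩|² dx dω < ∞}`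
(see `mem_formDomain_iff`). -/
def formDomain (φ : 𝓢(Conf d, ℂ)) (a : Phase d → ℝ) {h : ℝ} (hh : 0 < h) :
    Submodule ℂ (L2 d) where
  carrier := {f | MemLp (transform φ h f) 2 (symbolMeasure a)}
  add_mem' hf hg := by
    simp only [Set.mem_ofPred_eq] at *
    rw [transform_add φ hh]
    exact hf.add hg
  zero_mem' := by
    simp only [Set.mem_ofPred_eq]
    rw [transform_zero]
    exact MemLp.zero
  smul_mem' c f hf := by
    simp only [Set.mem_ofPred_eq] at *
    rw [transform_smul]
    exact hf.const_smul c

lemma mem_formDomain_iff (φ : 𝓢(Conf d, ℂ)) {a : Phase d → ℝ} (ha : AEMeasurable a volume)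
    {h : ℝ} (hh : 0 < h) (f : L2 d) :
    f ∈ formDomain φ a hh ↔
      ∫⁻ z, ENNReal.ofReal (a z) * ENNReal.ofReal (‖transform φ h f z‖ ^ 2) < ∞ := by
  have hm := (stronglyMeasurable_transform φ h f).aestronglyMeasurable (μ := symbolMeasure a)
  change MemLp (transform φ h f) 2 (symbolMeasure a) ↔ _
  rw [memLp_two_iff_integrable_sq_norm hm, Integrable, and_iff_right (show AEStronglyMeasurable (fun x => ‖transform φ h f x‖ ^ 2) (symbolMeasure a) from hm.norm.pow 2),
    hasFiniteIntegral_iff_ofReal (Filter.Eventually.of_forall fun z => by positivity),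
    symbolMeasure, lintegral_withDensity_eq_lintegral_mul_non_measurable₀ _ ha.ennreal_ofReal
      (Filter.Eventually.of_forall fun z => ENNReal.ofReal_lt_top)]
  rfl

/-- The sesquilinear form
`Q_{a,h}(f,g) = (2πh)^{-d} ∫ a(x,ω) ⟨f, φ^h_{(x,ω)}⟩ conj⟨g, φ^h_{(x,ω)}⟩ dx dω`
(see `form_eq`). -/
def form (φ : 𝓢(Conf d, ℂ)) (a : Phase d → ℝ) (h : ℝ) (f g : L2 d) : ℂ :=
  (((2 * Real.pi * h) ^ d)⁻¹ : ℝ) *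
    ∫ z, transform φ h f z * conj (transform φ h g z) ∂(symbolMeasure a)

lemma form_eq (φ : 𝓢(Conf d, ℂ)) {a : Phase d → ℝ} (ha : AEMeasurable a volume)
    (ha0 : ∀ᵐ z, 0 ≤ a z) (h : ℝ) (f g : L2 d) :
    form φ a h f g = (((2 * Real.pi * h) ^ d)⁻¹ : ℝ) *
      ∫ z, (a z : ℂ) * (transform φ h f z * conj (transform φ h g z)) := by
  rw [form, symbolMeasure, integral_withDensity_eq_integral_toReal_smul₀ ha.ennreal_ofReal
    (Filter.Eventually.of_forall fun z => ENNReal.ofReal_lt_top)]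
  congr 1
  refine integral_congr_ae ?_
  filter_upwards [ha0] with z hz
  rw [ENNReal.toReal_ofReal hz, real_smul]

lemma integrable_form (φ : 𝓢(Conf d, ℂ)) {a : Phase d → ℝ} {h : ℝ} (hh : 0 < h) {f g : L2 d}
    (hf : f ∈ formDomain φ a hh) (hg : g ∈ formDomain φ a hh) :
    Integrable (fun z => transform φ h f z * conj (transform φ h g z)) (symbolMeasure a) :=
  MemLp.integrable_mul (p := 2) (q := 2) hf (MemLp.star hg)

/-- The graph of the operator associated with the form: the pairs `(f, u)` with `f ∈ D_{a,h}`,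
`u ∈ L²` and `⟨u, g⟩ = Q_{a,h}(f, g)` for every `g ∈ D_{a,h}`, where `⟨u, g⟩ = ∫ u conj(g)` is
`inner ℂ g u`. -/
def operatorGraph (φ : 𝓢(Conf d, ℂ)) (a : Phase d → ℝ) {h : ℝ} (hh : 0 < h) :
    Submodule ℂ (L2 d × L2 d) where
  carrier := {p | p.1 ∈ formDomain φ a hh ∧
    ∀ g ∈ formDomain φ a hh, inner ℂ g p.2 = form φ a h p.1 g}
  add_mem' := by
    rintro ⟨f, u⟩ ⟨f', u'⟩ ⟨hf, hu⟩ ⟨hf', hu'⟩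
    refine ⟨add_mem hf hf', fun g hg => ?_⟩
    simp only [Prod.mk_add_mk] at *
    rw [inner_add_right, hu g hg, hu' g hg]
    simp only [form, transform_add φ hh, Pi.add_apply, add_mul]
    rw [integral_add (integrable_form φ hh hf hg) (integrable_form φ hh hf' hg), mul_add]
  zero_mem' := by
    refine ⟨zero_mem _, fun g hg => ?_⟩
    simp [form, transform_zero]
  smul_mem' := by
    rintro c ⟨f, u⟩ ⟨hf, hu⟩
    refine ⟨Submodule.smul_mem _ c hf, fun g hg => ?_⟩
    simp only [Prod.smul_mk] at *
    rw [inner_smul_right, hu g hg]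
    simp only [form, transform_smul, Pi.smul_apply, smul_eq_mul, mul_assoc]
    rw [integral_const_mul]
    ring

/-- The anti-Wick operator `A_{a,h}`: the unbounded operator in `L²(ℝ^d)` associated with the form
`Q_{a,h}` with form domain `D_{a,h}`. -/
def operator (φ : 𝓢(Conf d, ℂ)) (a : Phase d → ℝ) {h : ℝ} (hh : 0 < h) : L2 d →ₗ.[ℂ] L2 d :=
  (operatorGraph φ a hh).toLinearPMap

/-- If `D_{a,h}` is dense, the graph of `A_{a,h}` is indeed `operatorGraph`. -/
lemma graph_operator (φ : 𝓢(Conf d, ℂ)) (a : Phase d → ℝ) {h : ℝ} (hh : 0 < h)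
    (hD : Dense (formDomain φ a hh : Set (L2 d))) :
    (operator φ a hh).graph = operatorGraph φ a hh := by
  refine Submodule.toLinearPMap_graph_eq _ ?_
  rintro ⟨f, u⟩ ⟨-, hu⟩ hf
  simp only at hu hf ⊢
  subst hf
  refine hD.eq_zero_of_inner_left (𝕜 := ℂ) fun g hg => ?_
  rw [← inner_conj_symm, hu g hg]
  simp [form, transform_zero]

/-- `z` is in the resolvent set of the unbounded operator `T` if `T - z : dom T → H` has a bounded
everywhere defined two-sided inverse `R`. -/
def IsResolventPoint {H : Type*} [NormedAddCommGroup H] [InnerProductSpace ℂ H]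
    (T : H →ₗ.[ℂ] H) (z : ℂ) : Prop :=
  ∃ R : H →L[ℂ] H,
    (∀ v : H, ∃ hv : R v ∈ T.domain, T ⟨R v, hv⟩ - z • R v = v) ∧
    (∀ f : T.domain, R (T f - z • (f : H)) = f)

/-- The spectrum of an unbounded operator. -/
def opSpectrum {H : Type*} [NormedAddCommGroup H] [InnerProductSpace ℂ H]
    (T : H →ₗ.[ℂ] H) : Set ℂ :=
  {z | ¬ IsResolventPoint T z}

/-- The real spectrum, which is the whole spectrum when `T` is self-adjoint. -/
def realSpectrum {H : Type*} [NormedAddCommGroup H] [InnerProductSpace ℂ H]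
    (T : H →ₗ.[ℂ] H) : Set ℝ :=
  {t | (t : ℂ) ∈ opSpectrum T}

end AntiWick

end

/-!
# Spectral bottom of an anti-Wick operator with Muckenhoupt symbol

Write `V f (z) = ⟨f, φ^h_z⟩`. The orthogonality relation
`∫ |⟨f, ψ^h_z⟩|² dz = (2πh)^d ‖f‖² ‖ψ‖²` (`lintegral_enorm_sq_windowTransform`), which is
Plancherel's theorem in the frequency variable for each fixed position, controls everything below.

*The operator.* The form is `⟨T f, T g⟩`, where `T` is a multiple of `V`, viewed as an operator into
`L²(a dx dω)` (`formRoot`). It is closed because `V f (z)` depends continuously on `f` for each `z`,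
and it is densely defined because its domain contains the coherent states and these span a dense
subspace. Projecting orthogonally onto the graph of `T` gives the bounded positive operator
`R = (1 + T* T)⁻¹`. Hence `T* T` is self-adjoint, and the bottom of its spectrum is the spectral
point `‖R‖⁻¹ - 1`, which is also the infimum of `‖T f‖²` over unit vectors
(`IsFormOperator.exists_isLeast_realSpectrum`).

*Upper bound.* Test the form with the coherent state at `z`. Its transform decreases rapidly away
from `z` at scale `h^{1/2}` (`exists_overlap_decay`), whereas the weight `a` grows at most
polynomially at that scale (`exists_lintegral_profile_le`). So the form is bounded by a constant
times the average of `a` over the ball of radius `h^{1/2}` around `z`.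

*Lower bound.* By the Muckenhoupt condition, at every scale `r = θᵏ h^{1/2}` the symbol is bounded
below by a multiple of `λ(a,h)` on a set `S` that occupies the proportion `α` of each ball of radius
`r` (`exists_average_ball_ge`, `MuckenhouptAInf.volume_superlevel_ge`). When `r` is small compared
with `h^{1/2}`, the modulus `|V f|` hardly changes at scale `r` in the `L²` sense: moving `z`
modifies the window by a small time-frequency shift, and the orthogonality relation applies to the
difference of the windows. Averaging over balls shows that `S` carries a fixed part of `∫ |V f|²`
(`exists_concentration`). No analyticity of `V f` is needed, because the Muckenhoupt condition holds
at all small scales.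
-/

namespace AntiWick

open scoped FourierTransform

/-! ### The self-adjoint operator of a closed form -/

section ClosedForm

variable {H K : Type*} [NormedAddCommGroup H] [InnerProductSpace ℂ H]
  [NormedAddCommGroup K] [InnerProductSpace ℂ K]

/-- `A` is the operator associated with the form `(f, g) ↦ ⟨T f, T g⟩` on `T.domain`; in other
words, `A = T* T`. -/
def IsFormOperator (T : H →ₗ.[ℂ] K) (A : H →ₗ.[ℂ] H) : Prop :=
  ∀ f u : H, (f, u) ∈ A.graph ↔
    ∃ hf : f ∈ T.domain, ∀ g : T.domain, inner ℂ (g : H) u = inner ℂ (T g) (T ⟨f, hf⟩)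

/-- `R = (1 + T* T)⁻¹`, written weakly: `R u` is the element of `T.domain` that represents
`g ↦ ⟨u, g⟩` in the graph inner product of `T`. -/
def IsFormResolvent (T : H →ₗ.[ℂ] K) (R : H →L[ℂ] H) : Prop :=
  ∀ u : H, ∃ hf : R u ∈ T.domain, ∀ g : T.domain,
    inner ℂ (g : H) u = inner ℂ (g : H) (R u) + inner ℂ (T g) (T ⟨R u, hf⟩)

/-- The form resolvent of a closed operator exists: project `(u, 0)` orthogonally onto the graph
of `T` and keep the first component. -/
lemma exists_isFormResolvent [CompleteSpace H] [CompleteSpace K] {T : H →ₗ.[ℂ] K}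
    (hT : T.IsClosed) :
    ∃ R : H →L[ℂ] H, IsFormResolvent T R := by
  let e := WithLp.prodContinuousLinearEquiv 2 ℂ H K
  let G : Submodule ℂ (WithLp 2 (H × K)) := T.graph.comap (e : WithLp 2 (H × K) →ₗ[ℂ] H × K)
  have hG : IsClosed (G : Set (WithLp 2 (H × K))) := hT.preimage e.continuous
  have : CompleteSpace G := hG.completeSpace_coe
  refine ⟨ContinuousLinearMap.fst ℂ H K ∘L (e : WithLp 2 (H × K) →L[ℂ] H × K) ∘L
    G.starProjection ∘L (e.symm : H × K →L[ℂ] WithLp 2 (H × K)) ∘L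
    ContinuousLinearMap.inl ℂ H K, fun u => ?_⟩
  set v : WithLp 2 (H × K) := e.symm (u, 0)
  have hv : e (G.starProjection v) ∈ T.graph := G.starProjection_apply_mem v
  obtain ⟨f, hf1, hf2⟩ := (LinearPMap.mem_graph_iff T).1 hv
  have hf3 : (G.starProjection v).ofLp.1 = f := hf1.symm
  have hf4 : (G.starProjection v).ofLp.2 = T f := hf2.symm
  have hmem : (e (G.starProjection v)).1 ∈ T.domain := hf1 ▸ f.2
  refine ⟨hmem, fun g => ?_⟩
  have hg : e.symm ((g : H), T g) ∈ G := by
    change e (e.symm ((g : H), T g)) ∈ T.graph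
    rw [e.apply_symm_apply]
    exact LinearPMap.mem_graph T g
  have h0 := G.starProjection_inner_eq_zero v _ hg
  rw [← inner_conj_symm, map_eq_zero, inner_sub_right, sub_eq_zero, WithLp.prod_inner_apply,
    WithLp.prod_inner_apply, hf3, hf4] at h0
  have h1 : inner ℂ (g : H) u + inner ℂ (T g) (0 : K) =
    inner ℂ (g : H) (f : H) + inner ℂ (T g) (T f) := h0
  rw [inner_zero_right, add_zero] at h1
  rw [h1]
  have hf5 : f = ⟨(e (G.starProjection v)).1, hmem⟩ := Subtype.ext hf1
  congr 2
  rw [hf5]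
  rfl

variable {T : H →ₗ.[ℂ] K} {R : H →L[ℂ] H} {A : H →ₗ.[ℂ] H}

lemma IsFormResolvent.eq_of_forall (hR : IsFormResolvent T R) {f : T.domain} {u : H}
    (h : ∀ g : T.domain, inner ℂ (g : H) u = inner ℂ (g : H) (f : H) + inner ℂ (T g) (T f)) :
    R u = f := by
  obtain ⟨hu, hu'⟩ := hR u
  set w : T.domain := ⟨R u, hu⟩ - f
  have h1 := (h w).symm.trans (hu' w)
  have h2 : inner ℂ (w : H) (w : H) + inner ℂ (T w) (T w) = 0 := by
    have hw : (w : H) = R u - f := rfl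
    have hTw : T w = T ⟨R u, hu⟩ - T f := T.map_sub _ _
    nth_rewrite 2 [hw]
    nth_rewrite 2 [hTw]
    rw [inner_sub_right, inner_sub_right]
    linear_combination -h1
  rw [inner_self_eq_norm_sq_to_K, inner_self_eq_norm_sq_to_K] at h2
  have h3 : ‖(w : H)‖ ^ 2 + ‖T w‖ ^ 2 = 0 := by
    refine ofReal_injective ?_
    push_cast
    exact h2
  have h4 : ‖(w : H)‖ = 0 := by nlinarith [sq_nonneg ‖(w : H)‖, sq_nonneg ‖T w‖]
  exact sub_eq_zero.1 (norm_eq_zero.1 h4)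

lemma IsFormResolvent.inner_apply_self (hR : IsFormResolvent T R) (u : H) :
    ∃ hf : R u ∈ T.domain,
      inner ℂ (R u) u = ((‖R u‖ ^ 2 + ‖T ⟨R u, hf⟩‖ ^ 2 : ℝ) : ℂ) := by
  obtain ⟨hu, hu'⟩ := hR u
  refine ⟨hu, ?_⟩
  have h := hu' ⟨R u, hu⟩
  rw [inner_self_eq_norm_sq_to_K, inner_self_eq_norm_sq_to_K] at h
  simpa using h

lemma IsFormResolvent.nonneg (hR : IsFormResolvent T R) : 0 ≤ R := by
  rw [ContinuousLinearMap.nonneg_iff_isPositive, ContinuousLinearMap.isPositive_iff_complex]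
  intro u
  obtain ⟨hu, h⟩ := hR.inner_apply_self u
  rw [h]
  simp only [RCLike.re_to_complex, ofReal_re, true_and]
  positivity

lemma IsFormResolvent.isPositive (hR : IsFormResolvent T R) : R.IsPositive :=
  (ContinuousLinearMap.nonneg_iff_isPositive R).1 hR.nonneg

lemma IsFormResolvent.injective (hR : IsFormResolvent T R) (hd : Dense (T.domain : Set H)) :
    Function.Injective R := by
  rw [injective_iff_map_eq_zero]
  intro u hu
  obtain ⟨hf, h⟩ := hR u
  refine hd.eq_zero_of_inner_left (𝕜 := ℂ) fun g hg => ?_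
  have h1 := h ⟨g, hg⟩
  have h2 : (⟨R u, hf⟩ : T.domain) = 0 := Subtype.ext hu
  rw [h2, hu, T.map_zero, inner_zero_right, inner_zero_right, add_zero] at h1
  rw [← inner_conj_symm, h1, map_zero]

lemma IsFormOperator.apply_resolvent (hA : IsFormOperator T A) (hR : IsFormResolvent T R) (u : H) :
    ∃ hu : R u ∈ A.domain, A ⟨R u, hu⟩ = u - R u := by
  have h : (R u, u - R u) ∈ A.graph := by
    obtain ⟨hu, hu'⟩ := hR u
    refine (hA _ _).2 ⟨hu, fun g => ?_⟩
    rw [inner_sub_right, hu' g]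
    ring
  obtain ⟨y, hy1, hy2⟩ := (LinearPMap.mem_graph_iff A).1 h
  have hu : R u ∈ A.domain := by
    have := y.2
    rwa [hy1] at this
  refine ⟨hu, ?_⟩
  have : y = ⟨R u, hu⟩ := Subtype.ext hy1
  rw [← this, hy2]

lemma IsFormOperator.resolvent_apply (hA : IsFormOperator T A) (hR : IsFormResolvent T R)
    (f : A.domain) : R (A f + f) = f := by
  obtain ⟨hf, h⟩ := (hA _ _).1 (LinearPMap.mem_graph A f)
  refine hR.eq_of_forall (f := ⟨f, hf⟩) fun g => ?_
  rw [inner_add_right, h g, add_comm]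

/-- A symmetric operator `A` for which `A + 1` is onto is self-adjoint. -/
lemma IsFormOperator.isSelfAdjoint [CompleteSpace H] (hA : IsFormOperator T A)
    (hR : IsFormResolvent T R) (hd : Dense (T.domain : Set H)) : IsSelfAdjoint A := by
  have hsymm : ∀ u v : H, inner ℂ (R u) v = inner ℂ u (R v) :=
    hR.isPositive.isSymmetric
  have hdense : Dense (A.domain : Set H) := by
    rw [Submodule.dense_iff_topologicalClosure_eq_top, Submodule.topologicalClosure_eq_top_iff,
      Submodule.eq_bot_iff]
    intro v hv
    apply hR.injective hd
    rw [map_zero, ← inner_self_eq_zero (𝕜 := ℂ), ← hsymm]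
    obtain ⟨hu, -⟩ := hA.apply_resolvent hR (R v)
    exact (Submodule.mem_orthogonal _ _).1 hv _ hu
  have hformal : A.IsFormalAdjoint A := by
    intro f g
    have hf := hA.resolvent_apply hR f
    have hg := hA.resolvent_apply hR g
    have h := hsymm (A f + f) (A g + g)
    rw [hf, hg, inner_add_left, inner_add_right] at h
    linear_combination -h
  have hle := hformal.le_adjoint hdense
  rw [LinearPMap.isSelfAdjoint_def]
  refine (LinearPMap.eq_of_le_of_domain_eq hle (le_antisymm hle.1 fun g hg => ?_)).symm
  set w : H := A.adjoint ⟨g, hg⟩ + g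
  obtain ⟨hw, -⟩ := hA.apply_resolvent hR w
  have hgw : g = R w := by
    refine ext_inner_right ℂ fun v => ?_
    obtain ⟨hv, hv'⟩ := hA.apply_resolvent hR v
    have h1 := LinearPMap.adjoint_isFormalAdjoint hdense ⟨g, hg⟩ ⟨R v, hv⟩
    rw [hv'] at h1
    have h2 : inner ℂ w (R v) = inner ℂ g v := by
      rw [inner_add_left, h1, inner_sub_right]
      ring
    rw [hsymm, h2]
  rw [hgw]
  exact hw

/-- With `R = (A + 1)⁻¹`, the point `z` is in the resolvent set of `A` exactly if
`(A - z) R = 1 - (z + 1) R` is invertible. -/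
lemma IsFormOperator.isResolventPoint_iff (hA : IsFormOperator T A) (hR : IsFormResolvent T R)
    (z : ℂ) : IsResolventPoint A z ↔ IsUnit (1 - (z + 1) • R) := by
  have hAR : ∀ u : H, ∃ hu : R u ∈ A.domain, A ⟨R u, hu⟩ - z • R u = u - (z + 1) • R u := by
    intro u
    obtain ⟨hu, h⟩ := hA.apply_resolvent hR u
    exact ⟨hu, by rw [h, add_smul, one_smul]; abel⟩
  constructor
  · rintro ⟨S, hS1, hS2⟩
    refine isUnit_iff_exists.2 ⟨1 + (z + 1) • S, ?_, ?_⟩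
    · ext v
      obtain ⟨hv, h⟩ := hS1 v
      have h1 := hA.resolvent_apply hR ⟨S v, hv⟩
      have h2 : A ⟨S v, hv⟩ + S v = v + (z + 1) • S v := by
        nth_rewrite 3 [← h]
        rw [add_smul, one_smul]
        abel
      simp only [h2] at h1
      simp only [mul_apply_eq_comp, sub_apply,
        add_apply, one_apply_eq_self,
        smul_apply, h1, add_sub_cancel_right]
    · ext u
      obtain ⟨hu, h⟩ := hAR u
      have h1 := hS2 ⟨R u, hu⟩
      simp only [h] at h1
      simp only [mul_apply_eq_comp, sub_apply,
        add_apply, one_apply_eq_self,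
        smul_apply, h1, sub_add_cancel]
  · intro hU
    obtain ⟨U, hU1, hU2⟩ := isUnit_iff_exists.1 hU
    refine ⟨R * U, fun v => ?_, fun f => ?_⟩
    · obtain ⟨hu, h⟩ := hAR (U v)
      refine ⟨hu, ?_⟩
      have h1 : (1 - (z + 1) • R) (U v) = v := by
        rw [← mul_apply_eq_comp, hU1, one_apply_eq_self]
      exact h.trans h1
    · have h1 := hA.resolvent_apply hR f
      have h2 : A f - z • (f : H) = (1 - (z + 1) • R) (A f + f) := by
        rw [sub_apply, one_apply_eq_self, smul_apply, h1, add_smul, one_smul]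
        abel
      rw [h2, mul_apply_eq_comp, ← mul_apply_eq_comp U, hU2,
        one_apply_eq_self, h1]

/-- Away from `t = -1`, spectral points `t` of `A` correspond to spectral points `1 / (t + 1)` of
the resolvent. -/
lemma IsFormOperator.mem_realSpectrum_iff (hA : IsFormOperator T A) (hR : IsFormResolvent T R)
    {t : ℝ} (ht : t + 1 ≠ 0) : t ∈ realSpectrum A ↔ (t + 1)⁻¹ ∈ spectrum ℝ R := by
  have h1 : t ∈ realSpectrum A ↔ ¬ IsUnit (1 - (((t + 1 : ℝ) : ℂ)) • R) := by
    rw [ofReal_add, ofReal_one, ← hA.isResolventPoint_iff hR]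
    rfl
  rw [h1, spectrum.mem_iff, not_iff_not]
  have h2 : 1 - (((t + 1 : ℝ) : ℂ)) • R =
      (Units.mk0 (t + 1) ht) • (algebraMap ℝ (H →L[ℂ] H) (t + 1)⁻¹ - R) := by
    rw [smul_sub, Units.smul_mk0, Units.smul_mk0, Algebra.algebraMap_eq_smul_one, smul_smul,
      mul_inv_cancel₀ ht, one_smul]
    rfl
  rw [h2, isUnit_smul_iff]

/-- The bottom of the spectrum of `A = T* T` is a spectral point, and it is the infimum of
`‖T f‖²` over the unit vectors of the form domain. It equals `‖R‖⁻¹ - 1`, because `‖R‖` is the top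
of the spectrum of the positive operator `R`. -/
theorem IsFormOperator.exists_isLeast_realSpectrum [Nontrivial H] [CompleteSpace H]
    [CompleteSpace K] (hA : IsFormOperator T A) (hT : T.IsClosed) (hd : Dense (T.domain : Set H)) :
    IsSelfAdjoint A ∧ ∃ t₀ : ℝ, IsLeast (realSpectrum A) t₀ ∧
      (∀ m : ℝ, 0 ≤ m → (∀ f : T.domain, m * ‖(f : H)‖ ^ 2 ≤ ‖T f‖ ^ 2) → m ≤ t₀) ∧
      ∀ f : T.domain, t₀ * ‖(f : H)‖ ^ 2 ≤ ‖T f‖ ^ 2 := by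
  obtain ⟨R, hR⟩ := exists_isFormResolvent hT
  have hR0 : 0 < ‖R‖ := by
    rw [norm_pos_iff]
    rintro rfl
    obtain ⟨x, hx⟩ := exists_ne (0 : H)
    exact hx (hR.injective hd rfl)
  refine ⟨hA.isSelfAdjoint hR hd, ‖R‖⁻¹ - 1, ⟨?_, fun t ht => ?_⟩, fun m hm h => ?_, fun f => ?_⟩
  · rw [hA.mem_realSpectrum_iff hR (by rw [sub_add_cancel]; exact (inv_pos.2 hR0).ne'),
      sub_add_cancel, inv_inv]
    exact CStarAlgebra.norm_mem_spectrum_of_nonneg hR.nonneg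
  · have h1 : t + 1 ≠ 0 := by
      intro h0
      have hres : IsResolventPoint A (t : ℂ) := by
        rw [hA.isResolventPoint_iff hR]
        have : (t : ℂ) + 1 = 0 := by exact_mod_cast h0
        rw [this, zero_smul, sub_zero]
        exact isUnit_one
      exact ht hres
    rw [hA.mem_realSpectrum_iff hR h1] at ht
    have h2 : 0 ≤ (t + 1)⁻¹ := spectrum_nonneg_of_nonneg hR.nonneg ht
    have h3 : 0 < t + 1 := lt_of_le_of_ne (inv_nonneg.1 h2) h1.symm
    have h4 := spectrum.norm_le_norm_of_mem ht
    rw [Real.norm_of_nonneg h2] at h4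
    have h5 := inv_anti₀ (inv_pos.2 h3) h4
    rw [inv_inv] at h5
    linarith
  · have hle : ‖R‖ ≤ (m + 1)⁻¹ := by
      refine ContinuousLinearMap.opNorm_le_bound _ (by positivity) fun u => ?_
      obtain ⟨hf, h1⟩ := hR.inner_apply_self u
      have h2 : ‖R u‖ ^ 2 + ‖T ⟨R u, hf⟩‖ ^ 2 ≤ ‖R u‖ * ‖u‖ := by
        have h3 := norm_inner_le_norm (𝕜 := ℂ) (R u) u
        rw [h1, norm_real] at h3
        exact (le_abs_self _).trans h3
      have h4 := h ⟨R u, hf⟩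
      simp only at h4
      rw [inv_mul_eq_div, le_div_iff₀ (by positivity)]
      by_cases h0 : ‖R u‖ = 0
      · rw [h0, zero_mul]
        positivity
      · have h5 : 0 < ‖R u‖ := lt_of_le_of_ne (norm_nonneg _) (Ne.symm h0)
        refine le_of_mul_le_mul_left ?_ h5
        nlinarith
    have h5 := inv_anti₀ hR0 hle
    rw [inv_inv] at h5
    linarith
  · -- Cauchy-Schwarz in the graph inner product, applied to `⟨f, f⟩ = ⟨R f, f⟩_T`
    obtain ⟨hf, h1⟩ := hR f
    have h2 := h1 f
    obtain ⟨_, h3⟩ := hR.inner_apply_self f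
    set p := ‖R (f : H)‖
    set q := ‖T ⟨R f, hf⟩‖
    have h4 : p ^ 2 + q ^ 2 ≤ ‖R‖ * ‖(f : H)‖ ^ 2 := by
      have h5 := norm_inner_le_norm (𝕜 := ℂ) (R f) (f : H)
      rw [h3, norm_real] at h5
      have h6 := (le_abs_self _).trans h5
      have h7 := mul_le_mul_of_nonneg_right (R.le_opNorm (f : H)) (norm_nonneg (f : H))
      calc p ^ 2 + q ^ 2 ≤ _ := h6
        _ ≤ _ := h7
        _ = _ := by ring
    have h8 : ‖(f : H)‖ ^ 2 ≤ ‖(f : H)‖ * p + ‖T f‖ * q := by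
      have h9 : ‖inner ℂ (f : H) (f : H)‖ = ‖(f : H)‖ ^ 2 := by
        rw [inner_self_eq_norm_sq_to_K]
        simp
      rw [← h9, h2]
      exact (norm_add_le _ _).trans (add_le_add (norm_inner_le_norm _ _) (norm_inner_le_norm _ _))
    by_cases h0 : ‖(f : H)‖ = 0
    · rw [h0]
      simp only [ne_eq, OfNat.ofNat_ne_zero, not_false_eq_true, zero_pow, mul_zero]
      positivity
    have h10 : 0 < ‖(f : H)‖ ^ 2 := by positivity
    have h11 : (‖(f : H)‖ ^ 2) ^ 2 ≤ (‖(f : H)‖ ^ 2 + ‖T f‖ ^ 2) * (p ^ 2 + q ^ 2) := by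
      refine (pow_le_pow_left₀ h10.le h8 2).trans ?_
      nlinarith [sq_nonneg (‖(f : H)‖ * q - ‖T f‖ * p)]
    have h12 : (‖(f : H)‖ ^ 2) ^ 2 ≤
        (‖(f : H)‖ ^ 2 + ‖T f‖ ^ 2) * (‖R‖ * ‖(f : H)‖ ^ 2) :=
      h11.trans (mul_le_mul_of_nonneg_left h4 (by positivity))
    have h13 : ‖(f : H)‖ ^ 2 ≤ (‖(f : H)‖ ^ 2 + ‖T f‖ ^ 2) * ‖R‖ := by
      refine le_of_mul_le_mul_right ?_ h10
      nlinarith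
    have h14 : ‖R‖⁻¹ * ‖(f : H)‖ ^ 2 ≤ ‖(f : H)‖ ^ 2 + ‖T f‖ ^ 2 := by
      rw [inv_mul_le_iff₀ hR0]
      linarith
    linarith

end ClosedForm

/-! ### Muckenhoupt weights -/

/-- Decomposition of a decreasing profile into a sum over the balls of radii `θ⁻ᵏ`. -/
lemma ofReal_pow_le_tsum_indicator {X : Type*} [NormedAddCommGroup X] {θ : ℝ}
    (hθ : θ ∈ Set.Ioo (0 : ℝ) 1) (N : ℕ) (x : X) {r : ℝ} (hr : 0 < r) (y : X) :
    ENNReal.ofReal (((1 + ‖y - x‖ / r) ^ N)⁻¹) ≤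
      ∑' k : ℕ, ENNReal.ofReal ((θ ^ N)⁻¹ * (θ ^ N) ^ k) *
        (ball x ((θ⁻¹) ^ k * r)).indicator 1 y := by
  set s := ‖y - x‖ / r
  have hs : 0 ≤ s := by positivity
  have hθ1 : 1 < θ⁻¹ := (one_lt_inv₀ hθ.1).2 hθ.2
  have hθN : 0 < θ ^ N := pow_pos hθ.1 N
  obtain ⟨k, hk1, hk2⟩ : ∃ k : ℕ, s < (θ⁻¹) ^ k ∧ ((1 + s) ^ N)⁻¹ ≤ (θ ^ N)⁻¹ * (θ ^ N) ^ k := by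
    by_cases h : s < 1
    · refine ⟨0, by simpa using h, ?_⟩
      rw [pow_zero, mul_one]
      exact inv_anti₀ hθN (pow_le_pow_left₀ hθ.1.le (by linarith [hθ.2]) N)
    · obtain ⟨k, hk1, hk2⟩ := exists_nat_pow_near (not_lt.1 h) hθ1
      refine ⟨k + 1, hk2, ?_⟩
      rw [pow_succ, mul_comm ((θ ^ N) ^ k), inv_mul_cancel_left₀ hθN.ne', ← pow_mul, mul_comm N,
        pow_mul]
      have h2 : (θ⁻¹ ^ k) ^ N ≤ (1 + s) ^ N :=
        pow_le_pow_left₀ (by have := hθ.1; positivity) (by linarith) N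
      have h3 := inv_anti₀ (by have := hθ.1; positivity) h2
      rwa [inv_pow θ, inv_pow (θ ^ k), inv_inv] at h3
  refine le_trans ?_ (ENNReal.le_tsum k)
  rw [Set.indicator_of_mem, Pi.one_apply, mul_one]
  · exact ENNReal.ofReal_le_ofReal hk2
  · rw [mem_ball_iff_norm]
    exact (div_lt_iff₀ hr).1 hk1

section Muckenhoupt

variable {X : Type*} [NormedAddCommGroup X] [MeasureSpace X] {α : ℝ} {w : X → ℝ}

lemma MuckenhouptAInf.ae_nonneg (hw : MuckenhouptAInf α w) : ∀ᵐ x, 0 ≤ w x :=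
  hw.pos.mono fun _ h => h.le

lemma MuckenhouptAInf.setIntegral_nonneg (hw : MuckenhouptAInf α w) (s : Set X) :
    0 ≤ ∫ y in s, w y :=
  integral_nonneg_of_ae (ae_restrict_of_ae hw.ae_nonneg)

variable [NormedSpace ℝ X] [FiniteDimensional ℝ X]

lemma MuckenhouptAInf.integrableOn_ball (hw : MuckenhouptAInf α w) (x : X) (r : ℝ) :
    IntegrableOn w (ball x r) := by
  have : ProperSpace X := FiniteDimensional.proper ℝ X
  exact (hw.locallyIntegrable.integrableOn_isCompact (isCompact_closedBall x r)).mono_set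
    ball_subset_closedBall

lemma volume_real_ball_pos [(volume : Measure X).IsAddHaarMeasure] (x : X) {r : ℝ} (hr : 0 < r) :
    0 < (volume : Measure X).real (ball x r) :=
  ENNReal.toReal_pos (measure_ball_pos _ x hr).ne' measure_ball_lt_top.ne

lemma MuckenhouptAInf.lintegral_ball (hw : MuckenhouptAInf α w) (x : X) (r : ℝ) :
    ∫⁻ y in ball x r, ENNReal.ofReal (w y) = ENNReal.ofReal (∫ y in ball x r, w y) :=
  (ofReal_integral_eq_lintegral_ofReal (hw.integrableOn_ball x r)
    (ae_restrict_of_ae hw.ae_nonneg)).symm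

lemma MuckenhouptAInf.setIntegral_ball_pos [(volume : Measure X).IsAddHaarMeasure]
    (hw : MuckenhouptAInf α w) (x : X) {r : ℝ} (hr : 0 < r) :
    0 < ∫ y in ball x r, w y := by
  rw [setIntegral_pos_iff_support_of_nonneg_ae (ae_restrict_of_ae hw.ae_nonneg)
    (hw.integrableOn_ball x r)]
  have h1 : (Function.support w ∩ ball x r : Set X) =ᵐ[volume] ball x r := by
    filter_upwards [hw.pos] with y hy
    exact propext ⟨fun h => h.2, fun h => ⟨hy.ne', h⟩⟩
  rw [measure_congr h1]
  exact measure_ball_pos _ x hr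

variable [BorelSpace X] [(volume : Measure X).IsAddHaarMeasure]

variable (X) in
/-- Concentric balls whose radii differ by a suitable factor `θ` have volumes comparable up to the
factor `1 - α`, so the weight loses at most the factor `α` from one to the next. -/
lemma exists_shrink_factor (hα : α ∈ Set.Ioo (0 : ℝ) 1) :
    ∃ θ ∈ Set.Ioo (0 : ℝ) 1, ∀ w : X → ℝ, MuckenhouptAInf α w → ∀ (x : X) (r : ℝ), 0 < r →
      ∀ k : ℕ, α ^ k * ∫ y in ball x r, w y ≤ ∫ y in ball x (θ ^ k * r), w y := by
  set n := Module.finrank ℝ X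
  set θ : ℝ := 1 - α / (n + 1)
  have hn : (0 : ℝ) < n + 1 := by positivity
  have h0 : 0 < α / (n + 1) := div_pos hα.1 hn
  have h1 : α / (n + 1) < 1 := by
    rw [div_lt_one hn]
    linarith [hα.2, (Nat.cast_nonneg n : (0 : ℝ) ≤ n)]
  have hθ : θ ∈ Set.Ioo (0 : ℝ) 1 := ⟨by linarith, by linarith⟩
  -- Bernoulli's inequality
  have hpow : 1 - α ≤ θ ^ n := by
    have h2 := one_add_mul_le_pow (a := -(α / (n + 1))) (by linarith) n
    have h3 : n * (α / (n + 1)) ≤ α := by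
      rw [mul_div_assoc', div_le_iff₀ hn]
      nlinarith [hα.1]
    calc 1 - α ≤ 1 + n * -(α / (n + 1)) := by linarith
      _ ≤ (1 + -(α / (n + 1))) ^ n := h2
      _ = θ ^ n := by rw [← sub_eq_add_neg]
  refine ⟨θ, hθ, fun w hw x r hr k => ?_⟩
  have step : ∀ s : ℝ, 0 < s → α * ∫ y in ball x s, w y ≤ ∫ y in ball x (θ * s), w y := by
    intro s hs
    refine hw.condition x s hs _ measurableSet_ball.nullMeasurableSet
      (ball_subset_ball (by nlinarith [hθ.2])) ?_
    have hv : ∀ t : ℝ, 0 < t → (volume : Measure X).real (ball x t) =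
        t ^ n * (volume : Measure X).real (ball 0 1) := by
      intro t ht
      rw [Measure.real, Measure.real, Measure.addHaar_ball_of_pos _ _ ht, ENNReal.toReal_mul,
        ENNReal.toReal_ofReal (by positivity)]
    rw [hv s hs, hv _ (mul_pos hθ.1 hs), mul_pow, ← mul_assoc]
    gcongr
  induction k with
  | zero => simp
  | succ k ih =>
    have h4 := step (θ ^ k * r) (mul_pos (pow_pos hθ.1 k) hr)
    rw [← mul_assoc, ← pow_succ'] at h4
    refine le_trans ?_ h4
    rw [pow_succ', mul_assoc]
    exact mul_le_mul_of_nonneg_left ih hα.1.le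

variable (X) in
/-- A Muckenhoupt weight grows at most polynomially, so integrating it against a rapidly decreasing
profile centred at `x` gives no more than its mass near `x`. -/
lemma exists_lintegral_profile_le (hα : α ∈ Set.Ioo (0 : ℝ) 1) :
    ∃ (N : ℕ) (C : ℝ), 0 < C ∧ ∀ w : X → ℝ, MuckenhouptAInf α w → ∀ (x : X) (r : ℝ), 0 < r →
      ∫⁻ y, ENNReal.ofReal (w y) * ENNReal.ofReal (((1 + ‖y - x‖ / r) ^ N)⁻¹) ≤
        ENNReal.ofReal (C * ∫ y in ball x r, w y) := by
  obtain ⟨θ, hθ, hshrink⟩ := exists_shrink_factor X hα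
  -- with this `N`, the decay `θ ^ N` per step beats the growth `α⁻¹` of the mass by a factor `2`
  obtain ⟨N, hN⟩ := exists_pow_lt_of_lt_one (half_pos hα.1) hθ.2
  have hθN : 0 < θ ^ N := pow_pos hθ.1 N
  refine ⟨N, (θ ^ N)⁻¹ * 2, by positivity, fun w hw x r hr => ?_⟩
  set M := ∫ y in ball x r, w y
  have hM : 0 ≤ M := hw.setIntegral_nonneg _
  have hwm : AEMeasurable (fun y => ENNReal.ofReal (w y)) volume :=
    hw.locallyIntegrable.aestronglyMeasurable.aemeasurable.ennreal_ofReal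
  have hball : ∀ k : ℕ, ∫⁻ y in ball x ((θ⁻¹) ^ k * r), ENNReal.ofReal (w y) ≤
      ENNReal.ofReal ((α ^ k)⁻¹ * M) := by
    intro k
    rw [hw.lintegral_ball]
    refine ENNReal.ofReal_le_ofReal ?_
    have h1 := hshrink w hw x ((θ⁻¹) ^ k * r) (by have := hθ.1; positivity) k
    rw [← mul_assoc (θ ^ k), ← mul_pow, mul_inv_cancel₀ hθ.1.ne', one_pow, one_mul] at h1
    rw [le_inv_mul_iff₀ (pow_pos hα.1 k)]
    exact h1
  calc ∫⁻ y, ENNReal.ofReal (w y) * ENNReal.ofReal (((1 + ‖y - x‖ / r) ^ N)⁻¹)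
      ≤ ∫⁻ y, ∑' k : ℕ, ENNReal.ofReal ((θ ^ N)⁻¹ * (θ ^ N) ^ k) *
          (ball x ((θ⁻¹) ^ k * r)).indicator (fun y => ENNReal.ofReal (w y)) y := by
        refine lintegral_mono fun y => ?_
        refine (mul_le_mul_right (ofReal_pow_le_tsum_indicator hθ N x hr y) _).trans_eq ?_
        rw [← ENNReal.tsum_mul_left]
        refine tsum_congr fun k => ?_
        by_cases hy : y ∈ ball x ((θ⁻¹) ^ k * r)
        · rw [Set.indicator_of_mem hy, Set.indicator_of_mem hy, Pi.one_apply, mul_one, mul_comm]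
        · rw [Set.indicator_of_notMem hy, Set.indicator_of_notMem hy, mul_zero, mul_zero]
    _ = ∑' k : ℕ, ENNReal.ofReal ((θ ^ N)⁻¹ * (θ ^ N) ^ k) *
          ∫⁻ y in ball x ((θ⁻¹) ^ k * r), ENNReal.ofReal (w y) := by
        rw [lintegral_tsum fun k => (hwm.indicator measurableSet_ball).const_mul _]
        refine tsum_congr fun k => ?_
        rw [lintegral_const_mul'' _ (hwm.indicator measurableSet_ball),
          lintegral_indicator measurableSet_ball]
    _ ≤ ∑' k : ℕ, ENNReal.ofReal ((θ ^ N)⁻¹ * M * (1 / 2) ^ k) := by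
        refine ENNReal.tsum_le_tsum fun k => ?_
        refine (mul_le_mul_right (hball k) _).trans ?_
        rw [← ENNReal.ofReal_mul (by positivity)]
        refine ENNReal.ofReal_le_ofReal ?_
        have h1 : (θ ^ N) ^ k * (α ^ k)⁻¹ ≤ (1 / 2) ^ k := by
          rw [← inv_pow, ← mul_pow]
          refine pow_le_pow_left₀ (by have := hα.1; positivity) ?_ k
          rw [← div_eq_mul_inv, div_le_iff₀ hα.1]
          linarith
        calc (θ ^ N)⁻¹ * (θ ^ N) ^ k * ((α ^ k)⁻¹ * M)
            = (θ ^ N)⁻¹ * M * ((θ ^ N) ^ k * (α ^ k)⁻¹) := by ring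
          _ ≤ (θ ^ N)⁻¹ * M * (1 / 2) ^ k := by gcongr
    _ = ENNReal.ofReal ((θ ^ N)⁻¹ * 2 * M) := by
        rw [← ENNReal.ofReal_tsum_of_nonneg (fun k => by positivity)
          (summable_geometric_two.mul_left _), tsum_mul_left, tsum_geometric_two]
        congr 1
        ring

variable (X) in
/-- A lower bound for the averages of a Muckenhoupt weight at one scale gives one at every smaller
scale. -/
lemma exists_average_ball_ge (hα : α ∈ Set.Ioo (0 : ℝ) 1) :
    ∃ θ ∈ Set.Ioo (0 : ℝ) 1, ∀ w : X → ℝ, MuckenhouptAInf α w → ∀ (x : X) (r : ℝ), 0 < r →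
      ∀ k : ℕ, (α ^ k * ⨍ y in ball x r, w y) * volume.real (ball x (θ ^ k * r)) ≤
        ∫ y in ball x (θ ^ k * r), w y := by
  obtain ⟨θ, hθ, hshrink⟩ := exists_shrink_factor X hα
  refine ⟨θ, hθ, fun w hw x r hr k => le_trans ?_ (hshrink w hw x r hr k)⟩
  rw [setAverage_eq, smul_eq_mul]
  have h1 : (volume : Measure X).real (ball x (θ ^ k * r)) ≤ volume.real (ball x r) := by
    refine measureReal_mono (ball_subset_ball ?_) measure_ball_lt_top.ne
    have := pow_le_one₀ hθ.1.le hθ.2.le (n := k)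
    nlinarith
  have h2 := volume_real_ball_pos x hr
  have h3 := hw.setIntegral_nonneg (ball x r)
  have h4 : 0 < α ^ k := pow_pos hα.1 k
  calc α ^ k * ((volume.real (ball x r))⁻¹ * ∫ y in ball x r, w y) *
        volume.real (ball x (θ ^ k * r))
      ≤ α ^ k * ((volume.real (ball x r))⁻¹ * ∫ y in ball x r, w y) * volume.real (ball x r) := by
        gcongr
    _ = α ^ k * ∫ y in ball x r, w y := by
        field_simp

/-- On each ball, a Muckenhoupt weight is comparable with its average on a set of proportion at
least `α`. -/
lemma MuckenhouptAInf.volume_superlevel_ge (hw : MuckenhouptAInf α w)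
    (hα : α ∈ Set.Ioo (0 : ℝ) 1) (x : X) {r m : ℝ} (hr : 0 < r) (hm : 0 ≤ m)
    (hle : m * volume.real (ball x r) ≤ ∫ y in ball x r, w y) :
    α * volume.real (ball x r) ≤ volume.real (ball x r ∩ {y | α / 2 * m ≤ w y}) := by
  set S : Set X := {y | α / 2 * m ≤ w y}
  have hS : NullMeasurableSet S volume :=
    nullMeasurableSet_le aemeasurable_const hw.locallyIntegrable.aestronglyMeasurable.aemeasurable
  have hE : NullMeasurableSet (ball x r \ S) volume :=
    measurableSet_ball.nullMeasurableSet.diff hS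
  have hfin : (volume : Measure X) (ball x r) ≠ ∞ := measure_ball_lt_top.ne
  have hadd : volume.real (ball x r ∩ S) + volume.real (ball x r \ S) = volume.real (ball x r) :=
    measureReal_inter_add_sdiff₀ hS hfin
  by_contra! hlt
  have h1 := hw.condition x r hr _ hE Set.sdiff_subset (by linarith)
  have hEfin : (volume : Measure X) (ball x r \ S) ≠ ∞ :=
    measure_ne_top_of_subset Set.sdiff_subset hfin
  have h2 : ∫ y in ball x r \ S, w y ≤ α / 2 * m * volume.real (ball x r \ S) := by
    have h3 : ∫ y in ball x r \ S, w y ≤ ∫ _ in ball x r \ S, α / 2 * m := by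
      refine setIntegral_mono_on₀ ((hw.integrableOn_ball x r).mono_set Set.sdiff_subset)
        (integrableOn_const hEfin) hE fun y hy => ?_
      exact (not_le.1 hy.2).le
    rw [setIntegral_const, smul_eq_mul, mul_comm] at h3
    exact h3
  have h4 := hw.setIntegral_ball_pos x hr
  have h5 : volume.real (ball x r \ S) ≤ volume.real (ball x r) :=
    measureReal_mono Set.sdiff_subset hfin
  have h6 : α / 2 * m * volume.real (ball x r \ S) ≤ α / 2 * m * volume.real (ball x r) :=
    mul_le_mul_of_nonneg_left h5 (mul_nonneg (half_pos hα.1).le hm)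
  nlinarith [hα.1]

end Muckenhoupt

/-! ### Plancherel's theorem and the orthogonality relation -/

lemma eLpNorm_two_sq {Ω E : Type*} [MeasurableSpace Ω] [NormedAddCommGroup E] (μ : Measure Ω)
    (f : Ω → E) : eLpNorm f 2 μ ^ 2 = ∫⁻ x, ‖f x‖ₑ ^ 2 ∂μ := by
  have h := eLpNorm_nnreal_pow_eq_lintegral (f := f) (μ := μ) (p := 2) two_ne_zero
  simpa using h

section Plancherel

variable {V : Type*} [NormedAddCommGroup V] [InnerProductSpace ℝ V] [FiniteDimensional ℝ V]
  [MeasurableSpace V] [BorelSpace V]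

/-- On `L¹ ∩ L²`, the Fourier integral represents the `L²` Fourier transform: both define the same
tempered distribution. -/
lemma fourier_toLp_ae_eq {g : V → ℂ} (h1 : Integrable g) (h2 : MemLp g 2) :
    (𝓕 g : V → ℂ) =ᵐ[volume] (𝓕 (h2.toLp g) : Lp ℂ 2 (volume : Measure V)) := by
  have hcont : Continuous (𝓕 g : V → ℂ) :=
    VectorFourier.fourierIntegral_continuous Real.continuous_fourierChar
      (by exact continuous_inner) h1
  refine ae_eq_of_integral_contDiff_smul_eq hcont.locallyIntegrable
    ((Lp.memLp _).locallyIntegrable one_le_two) fun s hs hs' => ?_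
  have hc1 : HasCompactSupport (Complex.ofRealCLM ∘ s) := hs'.comp_left rfl
  have hc2 : ContDiff ℝ ((⊤ : ℕ∞) : WithTop ℕ∞) (Complex.ofRealCLM ∘ s) := by fun_prop
  set S : 𝓢(V, ℂ) := hc1.toSchwartzMap hc2
  have hS : ∀ x, S x = (s x : ℂ) := fun x => rfl
  have e1 : ∫ x, s x • (𝓕 (h2.toLp g) : Lp ℂ 2 (volume : Measure V)) x =
      ∫ x, (𝓕 S) x • (h2.toLp g) x := by
    have h3 := congrArg (fun D : 𝓢'(V, ℂ) => D S)
      (Lp.fourier_toTemperedDistribution_eq (h2.toLp g))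
    simp only [TemperedDistribution.fourier_apply, Lp.toTemperedDistribution_apply] at h3
    rw [h3]
    rfl
  have e2 : ∫ x, (𝓕 S) x • (h2.toLp g) x = ∫ x, (𝓕 S) x • g x := by
    refine integral_congr_ae ?_
    filter_upwards [h2.coeFn_toLp] with x hx
    rw [hx]
  have e3 : ∫ x, (𝓕 S) x • g x = ∫ x, S x • (𝓕 g : V → ℂ) x := by
    have h4 := VectorFourier.integral_fourierIntegral_smul_eq_flip (L := innerₗ V)
      Real.continuous_fourierChar (by exact continuous_inner) (S.integrable (μ := volume)) h1
    rw [flip_innerₗ] at h4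
    exact h4
  rw [e1, e2, e3]
  rfl

/-- Plancherel's theorem for the Fourier integral. -/
lemma lintegral_enorm_sq_fourier {g : V → ℂ} (h1 : Integrable g) (h2 : MemLp g 2) :
    ∫⁻ ξ, ‖(𝓕 g : V → ℂ) ξ‖ₑ ^ 2 = ∫⁻ x, ‖g x‖ₑ ^ 2 := by
  rw [← eLpNorm_two_sq, ← eLpNorm_two_sq, eLpNorm_congr_ae (fourier_toLp_ae_eq h1 h2),
    ← eLpNorm_congr_ae h2.coeFn_toLp, ← Lp.enorm_def, ← Lp.enorm_def, ← ofReal_norm,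
    ← ofReal_norm, Lp.norm_fourier_eq]

lemma lintegral_comp_smul (F : V → ℝ≥0∞) (hF : Measurable F) {c : ℝ} (hc : 0 < c) :
    ∫⁻ x, F (c • x) = ENNReal.ofReal ((c ^ Module.finrank ℝ V)⁻¹) * ∫⁻ x, F x := by
  rw [← lintegral_map (f := F) (g := fun x : V => c • x) hF (measurable_const_smul c),
    Measure.map_addHaar_smul _ hc.ne', lintegral_smul_measure, abs_of_pos (by positivity),
    smul_eq_mul]

end Plancherel

variable {d : ℕ}

/-- The coherent state built on an arbitrary window `ψ`, not necessarily a Schwartz function. -/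
noncomputable def window (ψ : Conf d → ℂ) (h : ℝ) (z : Phase d) (x : Conf d) : ℂ :=
  ((h ^ (-(d : ℝ) / 4) : ℝ) : ℂ) * exp (I / h * (inner ℝ z.snd x : ℝ)) *
    ψ (h ^ (-(1 / 2) : ℝ) • (x - z.fst))

/-- The transform `z ↦ ⟨f, ψ^h_z⟩` with an arbitrary window `ψ`. -/
noncomputable def windowTransform (ψ : Conf d → ℂ) (h : ℝ) (f : Conf d → ℂ) (z : Phase d) : ℂ :=
  ∫ y, f y * conj (window ψ h z y)

lemma window_coe (φ : 𝓢(Conf d, ℂ)) (h : ℝ) : window φ h = coherentState φ h := rfl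

lemma windowTransform_coe (φ : 𝓢(Conf d, ℂ)) (h : ℝ) (f : L2 d) :
    windowTransform φ h f = transform φ h f := rfl

lemma norm_exp_I_div_mul (h s : ℝ) : ‖exp (I / h * (s : ℂ))‖ = 1 := by
  have h2 : I / (h : ℂ) * (s : ℂ) = ((s / h : ℝ) : ℂ) * I := by
    push_cast; ring
  rw [h2, norm_exp_ofReal_mul_I]

lemma norm_window (ψ : Conf d → ℂ) {h : ℝ} (hh : 0 < h) (z : Phase d) (x : Conf d) :
    ‖window ψ h z x‖ = h ^ (-(d : ℝ) / 4) * ‖ψ (h ^ (-(1 / 2) : ℝ) • (x - z.fst))‖ := by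
  rw [window, norm_mul, norm_mul, norm_exp_I_div_mul, mul_one, norm_real,
    Real.norm_of_nonneg (Real.rpow_nonneg hh.le _)]

lemma continuous_window {ψ : Conf d → ℂ} (hψ : Continuous ψ) (h : ℝ) :
    Continuous (fun p : Phase d × Conf d => window ψ h p.1 p.2) := by
  unfold window
  fun_prop

/-- The `L²` normalization of coherent states: the square of the prefactor `h^{-d/4}` cancels the
Jacobian of the dilation by `h^{-1/2}`. -/
lemma rpow_scale_mul {h : ℝ} (hh : 0 < h) :
    ENNReal.ofReal (h ^ (-(d : ℝ) / 4)) ^ 2 *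
      ENNReal.ofReal (((h ^ (-(1 / 2) : ℝ)) ^ d)⁻¹) = 1 := by
  have h1 : 0 < h ^ (-(d : ℝ) / 4) := Real.rpow_pos_of_pos hh _
  rw [← ENNReal.ofReal_pow h1.le, ← ENNReal.ofReal_mul (by positivity), ← ENNReal.ofReal_one]
  congr 1
  rw [← Real.rpow_natCast, ← Real.rpow_natCast, ← Real.rpow_mul hh.le, ← Real.rpow_mul hh.le,
    ← Real.rpow_neg hh.le, ← Real.rpow_add hh]
  convert Real.rpow_zero h using 2
  push_cast
  ring

lemma lintegral_enorm_sq_window {ψ : Conf d → ℂ} (hψ : Continuous ψ) {h : ℝ} (hh : 0 < h)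
    (z : Phase d) : ∫⁻ x, ‖window ψ h z x‖ₑ ^ 2 = ∫⁻ t, ‖ψ t‖ₑ ^ 2 := by
  have h1 : 0 < h ^ (-(1 / 2) : ℝ) := Real.rpow_pos_of_pos hh _
  have h2 : ∀ x, ‖window ψ h z x‖ₑ ^ 2 = ENNReal.ofReal (h ^ (-(d : ℝ) / 4)) ^ 2 *
      ‖ψ (h ^ (-(1 / 2) : ℝ) • (x - z.fst))‖ₑ ^ 2 := by
    intro x
    rw [← ofReal_norm, norm_window ψ hh, ENNReal.ofReal_mul (Real.rpow_nonneg hh.le _), mul_pow,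
      ofReal_norm]
  have hm : Measurable fun t => ‖ψ t‖ₑ ^ 2 := (hψ.measurable.enorm).pow_const 2
  have hm' : Measurable fun x => ‖ψ (h ^ (-(1 / 2) : ℝ) • (x - z.fst))‖ₑ ^ 2 := by
    have hc : Continuous fun x => ψ (h ^ (-(1 / 2) : ℝ) • (x - z.fst)) := by fun_prop
    exact hc.measurable.enorm.pow_const 2
  simp_rw [h2]
  rw [lintegral_const_mul _ hm',
    lintegral_sub_right_eq_self (fun x => ‖ψ (h ^ (-(1 / 2) : ℝ) • x)‖ₑ ^ 2),
    lintegral_comp_smul _ hm h1, finrank_euclideanSpace_fin, ← mul_assoc, rpow_scale_mul hh,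
    one_mul]

lemma memLp_window {ψ : Conf d → ℂ} (hψ : Continuous ψ) (hψ2 : MemLp ψ 2) {h : ℝ} (hh : 0 < h)
    (z : Phase d) : MemLp (window ψ h z) 2 := by
  have hc : Continuous (window ψ h z) := by
    unfold window
    fun_prop
  refine ⟨hc.aestronglyMeasurable, ?_⟩
  have h1 : eLpNorm (window ψ h z) 2 volume ^ 2 = eLpNorm ψ 2 volume ^ 2 := by
    rw [eLpNorm_two_sq, eLpNorm_two_sq, lintegral_enorm_sq_window hψ hh]
  exact lt_of_eq_of_lt ((ENNReal.pow_right_strictMono two_ne_zero).injective h1) hψ2.2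

lemma integrable_windowTransform {ψ : Conf d → ℂ} (hψ : Continuous ψ) (hψ2 : MemLp ψ 2) {h : ℝ}
    (hh : 0 < h) {f : Conf d → ℂ} (hf : MemLp f 2) (z : Phase d) :
    Integrable (fun y => f y * conj (window ψ h z y)) :=
  MemLp.integrable_mul (p := 2) (q := 2) hf (memLp_window hψ hψ2 hh z).star

/-- For a fixed position `x`, the function whose Fourier transform is `ω ↦ ⟨f, ψ^h_{(x,ω)}⟩`. -/
lemma windowTransform_eq_fourier (ψ : Conf d → ℂ) (h : ℝ) (f : Conf d → ℂ) (x ω : Conf d) :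
    windowTransform ψ h f (WithLp.toLp 2 (x, ω)) =
      (𝓕 (fun y => f y * conj (window ψ h (WithLp.toLp 2 (x, 0)) y)) : Conf d → ℂ)
        ((2 * Real.pi * h)⁻¹ • ω) := by
  rw [Real.fourier_eq', windowTransform]
  refine integral_congr_ae (Filter.Eventually.of_forall fun y => ?_)
  simp only [window, WithLp.toLp_fst, WithLp.toLp_snd, inner_zero_left, ofReal_zero, mul_zero,
    exp_zero, mul_one, map_mul, smul_eq_mul, ← exp_conj, inner_smul_right, map_div₀, conj_I,
    conj_ofReal]
  have h1 : ((-2 * Real.pi * ((2 * Real.pi * h)⁻¹ * inner ℝ y ω) : ℝ) : ℂ) * I =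
      -I / h * (inner ℝ ω y : ℝ) := by
    rw [real_inner_comm y ω]
    by_cases hh : h = 0
    · simp [hh]
    · have hp : (Real.pi : ℂ) ≠ 0 := by exact_mod_cast Real.pi_ne_zero
      have hh' : (h : ℂ) ≠ 0 := by exact_mod_cast hh
      push_cast
      field_simp
  rw [h1]
  ring

lemma stronglyMeasurable_windowTransform {ψ : Conf d → ℂ} (hψ : Continuous ψ) (h : ℝ)
    {f : Conf d → ℂ} (hf : StronglyMeasurable f) :
    StronglyMeasurable (windowTransform ψ h f) := by
  refine StronglyMeasurable.integral_prod_right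
    (f := fun z y => f y * conj (window ψ h z y)) ?_
  exact (hf.comp_measurable measurable_snd).mul
    (continuous_conj.comp (continuous_window hψ h)).stronglyMeasurable

lemma lintegral_phase (F : Phase d → ℝ≥0∞) (hF : Measurable F) :
    ∫⁻ z, F z = ∫⁻ x : Conf d, ∫⁻ ω : Conf d, F (WithLp.toLp 2 (x, ω)) := by
  have h1 := WithLp.volume_preserving_toLp (Conf d) (Conf d)
  rw [← h1.lintegral_comp hF, Measure.volume_eq_prod,
    lintegral_prod (fun p : Conf d × Conf d => F (WithLp.toLp 2 p))
      (hF.comp h1.measurable).aemeasurable]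

/-- The orthogonality relation (Moyal identity): up to normalization, `f ↦ ⟨f, ψ^h_z⟩` multiplies
`L²` norms by the norm of the window. For each fixed position it is Plancherel's theorem in the
frequency variable. -/
theorem lintegral_enorm_sq_windowTransform {ψ : Conf d → ℂ} (hψ : Continuous ψ) (hψ2 : MemLp ψ 2)
    {M : ℝ} (hM : ∀ t, ‖ψ t‖ ≤ M) {h : ℝ} (hh : 0 < h) {f : Conf d → ℂ}
    (hfm : StronglyMeasurable f) (hf : MemLp f 2) :
    ∫⁻ z, ‖windowTransform ψ h f z‖ₑ ^ 2 =
      ENNReal.ofReal ((2 * Real.pi * h) ^ d) * ((∫⁻ y, ‖f y‖ₑ ^ 2) * ∫⁻ t, ‖ψ t‖ₑ ^ 2) := by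
  have hmeas := (stronglyMeasurable_windowTransform hψ h hfm).measurable
  have hc : 0 < 2 * Real.pi * h := by positivity
  rw [lintegral_phase _ (hmeas.enorm.pow_const 2)]
  have hinner : ∀ x : Conf d,
      ∫⁻ ω : Conf d, ‖windowTransform ψ h f (WithLp.toLp 2 (x, ω))‖ₑ ^ 2 =
        ENNReal.ofReal ((2 * Real.pi * h) ^ d) *
          ∫⁻ y, ‖f y‖ₑ ^ 2 * ‖window ψ h (WithLp.toLp 2 (x, 0)) y‖ₑ ^ 2 := by
    intro x
    set z : Phase d := WithLp.toLp 2 (x, 0)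
    set g : Conf d → ℂ := fun y => f y * conj (window ψ h z y)
    have hg1 : Integrable g := integrable_windowTransform hψ hψ2 hh hf z
    have hg2 : MemLp g 2 := by
      refine hf.of_le_mul (c := h ^ (-(d : ℝ) / 4) * M) hg1.1
        (Filter.Eventually.of_forall fun y => ?_)
      have h0 : 0 ≤ h ^ (-(d : ℝ) / 4) := Real.rpow_nonneg hh.le _
      rw [norm_mul, RCLike.norm_conj, norm_window ψ hh, mul_comm]
      gcongr
      exact hM _
    have hgc : Continuous (𝓕 g : Conf d → ℂ) :=
      VectorFourier.fourierIntegral_continuous Real.continuous_fourierChar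
        (by exact continuous_inner) hg1
    simp_rw [windowTransform_eq_fourier]
    rw [lintegral_comp_smul (fun ξ => ‖(𝓕 g : Conf d → ℂ) ξ‖ₑ ^ 2)
      (hgc.measurable.enorm.pow_const 2) (inv_pos.2 hc), finrank_euclideanSpace_fin, inv_pow,
      inv_inv, lintegral_enorm_sq_fourier hg1 hg2]
    congr 1
    refine lintegral_congr fun y => ?_
    rw [enorm_mul, mul_pow]
    congr 2
    exact RCLike.enorm_conj _
  simp_rw [hinner]
  have hwm : Measurable fun p : Conf d × Conf d =>
      ‖window ψ h (WithLp.toLp 2 (p.1, 0)) p.2‖ₑ ^ 2 := by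
    have hcw : Continuous fun p : Conf d × Conf d =>
        window ψ h (WithLp.toLp 2 (p.1, 0)) p.2 := by
      unfold window
      simp only [WithLp.toLp_fst, WithLp.toLp_snd]
      fun_prop
    exact hcw.measurable.enorm.pow_const 2
  have hfm' : Measurable fun y => ‖f y‖ₑ ^ 2 := hfm.measurable.enorm.pow_const 2
  have hprod : Measurable fun p : Conf d × Conf d =>
      ‖f p.2‖ₑ ^ 2 * ‖window ψ h (WithLp.toLp 2 (p.1, 0)) p.2‖ₑ ^ 2 :=
    (hfm'.comp measurable_snd).mul hwm
  rw [lintegral_const_mul _ hprod.lintegral_prod_right',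
    lintegral_lintegral_swap hprod.aemeasurable]
  congr 1
  -- the window depends on `x` and `y` only through `y - x`, up to a phase
  have hsymm : ∀ y : Conf d, ∫⁻ x : Conf d, ‖window ψ h (WithLp.toLp 2 (x, 0)) y‖ₑ ^ 2 =
      ∫⁻ t, ‖ψ t‖ₑ ^ 2 := by
    intro y
    rw [← lintegral_enorm_sq_window hψ hh 0,
      ← lintegral_sub_left_eq_self (fun x => ‖window ψ h 0 x‖ₑ ^ 2) y]
    refine lintegral_congr fun x => ?_
    rw [← ofReal_norm, ← ofReal_norm, norm_window ψ hh, norm_window ψ hh]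
    simp
  have : ∀ y : Conf d, ∫⁻ x : Conf d,
      ‖f y‖ₑ ^ 2 * ‖window ψ h (WithLp.toLp 2 (x, 0)) y‖ₑ ^ 2 =
        ‖f y‖ₑ ^ 2 * ∫⁻ t, ‖ψ t‖ₑ ^ 2 := by
    intro y
    have hx : Measurable fun x : Conf d => ‖window ψ h (WithLp.toLp 2 (x, 0)) y‖ₑ ^ 2 := by
      have hcx : Continuous fun x : Conf d => window ψ h (WithLp.toLp 2 (x, 0)) y := by
        unfold window
        simp only [WithLp.toLp_fst, WithLp.toLp_snd]
        fun_prop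
      exact hcx.measurable.enorm.pow_const 2
    rw [lintegral_const_mul _ hx, hsymm]
  simp_rw [this]
  rw [lintegral_mul_const _ hfm']

/-! ### Time-frequency shifts of a Schwartz window -/

/-- The time-frequency shift `t ↦ exp(i ω · t) ψ(t - x)` of a window by `v = (x, ω)`. -/
noncomputable def tfShift (v : Phase d) (ψ : Conf d → ℂ) (t : Conf d) : ℂ :=
  exp (I * (inner ℝ v.snd t : ℝ)) * ψ (t - v.fst)

lemma norm_tfShift (v : Phase d) (ψ : Conf d → ℂ) (t : Conf d) :
    ‖tfShift v ψ t‖ = ‖ψ (t - v.fst)‖ := by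
  rw [tfShift, norm_mul, mul_comm I, norm_exp_ofReal_mul_I, one_mul]

lemma continuous_tfShift_right {ψ : Conf d → ℂ} (hψ : Continuous ψ) (v : Phase d) :
    Continuous (tfShift v ψ) := by
  unfold tfShift
  fun_prop

lemma memLp_tfShift {ψ : Conf d → ℂ} (hψ : Continuous ψ) (hψ2 : MemLp ψ 2) (v : Phase d) :
    MemLp (tfShift v ψ) 2 := by
  have h1 : MemLp (fun t => ψ (t - v.fst)) 2 :=
    hψ2.comp_measurePreserving (measurePreserving_sub_right volume v.fst)
  exact h1.of_le (continuous_tfShift_right hψ v).aestronglyMeasurable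
    (Filter.Eventually.of_forall fun t => (norm_tfShift v ψ t).le)

/-- Moving the centre of a coherent state amounts to a time-frequency shift of its window, up to a
phase that does not depend on the position. -/
lemma window_add (ψ : Conf d → ℂ) {h : ℝ} (hh : 0 < h) (z u : Phase d) (y : Conf d) :
    window ψ h (z + u) y = exp (I / h * (inner ℝ u.snd z.fst : ℝ)) *
      window (tfShift (h ^ (-(1 / 2) : ℝ) • u) ψ) h z y := by
  have h1 : h ^ (-(1 / 2) : ℝ) * h ^ (-(1 / 2) : ℝ) = h⁻¹ := by
    rw [← Real.rpow_add hh, ← Real.rpow_neg_one]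
    norm_num
  have h2 : h ^ (-(1 / 2) : ℝ) • (y - (z + u).fst) =
      h ^ (-(1 / 2) : ℝ) • (y - z.fst) - (h ^ (-(1 / 2) : ℝ) • u).fst := by
    rw [WithLp.add_fst, WithLp.smul_fst, ← smul_sub, sub_sub]
  have h3 : exp (I / h * (inner ℝ (z + u).snd y : ℝ)) = exp (I / h * (inner ℝ u.snd z.fst : ℝ)) *
      (exp (I / h * (inner ℝ z.snd y : ℝ)) * exp (I * (inner ℝ (h ^ (-(1 / 2) : ℝ) • u).snd
        (h ^ (-(1 / 2) : ℝ) • (y - z.fst)) : ℝ))) := by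
    rw [← exp_add, ← exp_add]
    congr 1
    rw [WithLp.smul_snd, real_inner_smul_left, real_inner_smul_right, ← mul_assoc, h1,
      WithLp.add_snd, inner_add_left, inner_sub_right]
    push_cast
    ring
  rw [window, h2, h3, window, tfShift]
  ring

lemma windowTransform_add (ψ : Conf d → ℂ) {h : ℝ} (hh : 0 < h) (f : Conf d → ℂ)
    (z u : Phase d) :
    windowTransform ψ h f (z + u) = conj (exp (I / h * (inner ℝ u.snd z.fst : ℝ))) *
      windowTransform (tfShift (h ^ (-(1 / 2) : ℝ) • u) ψ) h f z := by
  rw [windowTransform, windowTransform, ← integral_const_mul]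
  refine integral_congr_ae (Filter.Eventually.of_forall fun y => ?_)
  simp only [window_add ψ hh, map_mul]
  ring

lemma norm_windowTransform_add (ψ : Conf d → ℂ) {h : ℝ} (hh : 0 < h) (f : Conf d → ℂ)
    (z u : Phase d) : ‖windowTransform ψ h f (z + u)‖ =
      ‖windowTransform (tfShift (h ^ (-(1 / 2) : ℝ) • u) ψ) h f z‖ := by
  rw [windowTransform_add ψ hh, norm_mul, RCLike.norm_conj, norm_exp_I_div_mul, one_mul]

/-- The modulus of the overlap of two coherent states depends only on their displacement in phase
space, measured in units of `h^{1/2}`. -/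
lemma norm_transform_coherentState (φ : 𝓢(Conf d, ℂ)) {h : ℝ} (hh : 0 < h) (z u : Phase d) :
    ‖windowTransform φ h (coherentState φ h z) (z + u)‖ =
      ‖∫ t, φ t * conj (tfShift (h ^ (-(1 / 2) : ℝ) • u) φ t)‖ := by
  rw [norm_windowTransform_add _ hh, windowTransform]
  set v := h ^ (-(1 / 2) : ℝ) • u
  set c := h ^ (-(1 / 2) : ℝ)
  have hc : 0 < c := Real.rpow_pos_of_pos hh _
  set b := h ^ (-(d : ℝ) / 4)
  have hb : 0 < b := Real.rpow_pos_of_pos hh _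
  have h1 : ∀ y, coherentState φ h z y * conj (window (tfShift v φ) h z y) =
      ((b ^ 2 : ℝ) : ℂ) * (φ (c • (y - z.fst)) * conj (tfShift v φ (c • (y - z.fst)))) := by
    intro y
    have h2 := norm_exp_I_div_mul h (inner ℝ z.snd y)
    set e := exp (I / h * (inner ℝ z.snd y : ℝ))
    have h3 : e * conj e = 1 := by rw [mul_conj, normSq_eq_norm_sq, h2]; norm_num
    have h4 : coherentState φ h z y = (b : ℂ) * e * φ (c • (y - z.fst)) := rfl
    have h5 : window (tfShift v φ) h z y = (b : ℂ) * e * tfShift v φ (c • (y - z.fst)) := rfl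
    rw [h4, h5, map_mul, map_mul, conj_ofReal, ofReal_pow]
    linear_combination (b : ℂ) ^ 2 * φ (c • (y - z.fst)) *
      conj (tfShift v φ (c • (y - z.fst))) * h3
  simp_rw [h1]
  rw [integral_const_mul,
    integral_sub_right_eq_self (fun y => φ (c • y) * conj (tfShift v φ (c • y))),
    Measure.integral_comp_smul volume (fun t => φ t * conj (tfShift v φ t)),
    finrank_euclideanSpace_fin, norm_mul, norm_smul, norm_real, ← mul_assoc]
  have h6 : ‖b ^ 2‖ * ‖|(c ^ d)⁻¹|‖ = 1 := by
    have h7 := congrArg ENNReal.toReal (rpow_scale_mul (d := d) hh)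
    rw [ENNReal.toReal_mul, ENNReal.toReal_pow, ENNReal.toReal_ofReal hb.le,
      ENNReal.toReal_ofReal (by positivity), ENNReal.toReal_one] at h7
    rw [norm_abs_eq_norm, Real.norm_of_nonneg (by positivity), Real.norm_of_nonneg (by positivity)]
    exact h7
  rw [h6, one_mul]

lemma exists_schwartz_decay (p : 𝓢(Conf d, ℂ)) (N : ℕ) :
    ∃ C : ℝ, 0 < C ∧ ∀ t, (1 + ‖t‖) ^ N * ‖p t‖ ≤ C := by
  refine ⟨2 ^ N * ((Finset.Iic (N, 0)).sup fun m => SchwartzMap.seminorm ℝ m.1 m.2) p + 1, ?_,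
    fun t => ?_⟩
  · have := apply_nonneg ((Finset.Iic (N, 0)).sup fun m => SchwartzMap.seminorm ℝ m.1 m.2) p
    positivity
  · have h := SchwartzMap.one_add_le_sup_seminorm_apply (𝕜 := ℝ) (m := (N, 0)) (k := N) (n := 0)
      le_rfl le_rfl p t
    rw [norm_iteratedFDeriv_zero] at h
    linarith

lemma one_add_norm_le_mul {E : Type*} [SeminormedAddCommGroup E] (x y : E) :
    1 + ‖x + y‖ ≤ (1 + ‖x‖) * (1 + ‖y‖) := by
  nlinarith [norm_add_le x y, norm_nonneg x, norm_nonneg y]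

/-- The correlation of two Schwartz functions decreases rapidly. -/
lemma exists_correlation_decay (p q : 𝓢(Conf d, ℂ)) (N : ℕ) :
    ∃ C : ℝ, 0 < C ∧ ∀ x, (1 + ‖x‖) ^ N * ∫ t, ‖p t‖ * ‖q (t + x)‖ ≤ C := by
  obtain ⟨P, hP0, hP⟩ := exists_schwartz_decay p (N + (d + 1))
  obtain ⟨Q, hQ0, hQ⟩ := exists_schwartz_decay q N
  have hint : Integrable (fun t : Conf d => (1 + ‖t‖) ^ (-((d + 1 : ℕ) : ℝ))) :=
    integrable_one_add_norm (by rw [finrank_euclideanSpace_fin]; exact_mod_cast Nat.lt_succ_self d)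
  set J := ∫ t : Conf d, (1 + ‖t‖) ^ (-((d + 1 : ℕ) : ℝ))
  have hJ : 0 ≤ J := integral_nonneg fun t => by positivity
  refine ⟨P * Q * J + 1, by positivity, fun x => ?_⟩
  have hpt : ∀ t, (1 + ‖x‖) ^ N * (‖p t‖ * ‖q (t + x)‖) ≤
      P * Q * (1 + ‖t‖) ^ (-((d + 1 : ℕ) : ℝ)) := by
    intro t
    have h1 : 1 + ‖x‖ ≤ (1 + ‖t + x‖) * (1 + ‖t‖) := by
      have := one_add_norm_le_mul (t + x) (-t)
      rwa [norm_neg, add_comm t x, add_neg_cancel_right, add_comm x t] at this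
    have h2 : 0 < (1 + ‖t‖) ^ (d + 1) := by positivity
    rw [Real.rpow_neg (by positivity), Real.rpow_natCast, ← div_eq_mul_inv, le_div_iff₀ h2]
    calc (1 + ‖x‖) ^ N * (‖p t‖ * ‖q (t + x)‖) * (1 + ‖t‖) ^ (d + 1)
        ≤ ((1 + ‖t + x‖) * (1 + ‖t‖)) ^ N * (‖p t‖ * ‖q (t + x)‖) * (1 + ‖t‖) ^ (d + 1) := by
          gcongr
      _ = ((1 + ‖t‖) ^ (N + (d + 1)) * ‖p t‖) * ((1 + ‖t + x‖) ^ N * ‖q (t + x)‖) := by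
          rw [mul_pow, pow_add]
          ring
      _ ≤ P * Q := by
          gcongr
          · exact hP t
          · exact hQ (t + x)
  rw [← integral_const_mul]
  have h3 : ∫ t, (1 + ‖x‖) ^ N * (‖p t‖ * ‖q (t + x)‖) ≤
      ∫ t : Conf d, P * Q * (1 + ‖t‖) ^ (-((d + 1 : ℕ) : ℝ)) :=
    integral_mono_of_nonneg (Filter.Eventually.of_forall fun t => by positivity)
      (hint.const_mul _) (Filter.Eventually.of_forall hpt)
  exact (h3.trans_eq (integral_const_mul _ _)).trans (le_add_of_nonneg_right zero_le_one)

/-- The Fourier side of the overlap `⟨φ, π(v) φ⟩`, in which the roles of position and frequency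
are exchanged. -/
lemma norm_overlap_le_fourier (φ : 𝓢(Conf d, ℂ)) (v : Phase d) :
    ‖∫ t, φ t * conj (tfShift v φ t)‖ ≤
      ∫ ξ, ‖(𝓕⁻ φ) ξ‖ * ‖(𝓕⁻ φ) (ξ + (2 * Real.pi)⁻¹ • v.snd)‖ := by
  set ψ : 𝓢(Conf d, ℂ) := 𝓕⁻ φ
  have hφ : φ = 𝓕 ψ := (FourierTransform.fourier_fourierInv_eq φ).symm
  set g : Conf d → ℂ := fun t => conj (tfShift v φ t)
  have hg : Integrable g := by
    have h1 : Integrable (fun t => φ (t - v.fst)) :=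
      (φ.integrable (μ := volume)).comp_sub_right v.fst
    refine h1.mono (continuous_conj.comp
      (continuous_tfShift_right φ.continuous v)).aestronglyMeasurable
      (Filter.Eventually.of_forall fun t => ?_)
    rw [RCLike.norm_conj, norm_tfShift]
  have h2 : ∫ t, φ t * g t = ∫ ξ, ψ ξ * (𝓕 g : Conf d → ℂ) ξ := by
    have h3 := VectorFourier.integral_fourierIntegral_smul_eq_flip (L := innerₗ (Conf d))
      Real.continuous_fourierChar (by exact continuous_inner) (ψ.integrable (μ := volume)) hg
    rw [flip_innerₗ] at h3
    nth_rewrite 1 [hφ]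
    exact h3
  have h4 : ∀ ξ, ‖(𝓕 g : Conf d → ℂ) ξ‖ = ‖ψ (ξ + (2 * Real.pi)⁻¹ • v.snd)‖ := by
    intro ξ
    set η := ξ + (2 * Real.pi)⁻¹ • v.snd
    have h5 : (𝓕 g : Conf d → ℂ) ξ =
        conj (∫ t, exp ((2 * Real.pi * inner ℝ t η : ℝ) * I) * φ (t - v.fst)) := by
      rw [Real.fourier_eq', ← integral_conj]
      refine integral_congr_ae (Filter.Eventually.of_forall fun t => ?_)
      simp only [g, tfShift, map_mul, ← exp_conj, conj_I, conj_ofReal, smul_eq_mul, ← mul_assoc,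
        ← exp_add]
      congr 2
      simp only [η, inner_add_right, real_inner_smul_right, real_inner_comm v.snd t]
      have hp : (Real.pi : ℂ) ≠ 0 := by exact_mod_cast Real.pi_ne_zero
      push_cast
      field_simp
      ring
    have h6 : ∫ t, exp ((2 * Real.pi * inner ℝ t η : ℝ) * I) * φ (t - v.fst) =
        exp ((2 * Real.pi * inner ℝ v.fst η : ℝ) * I) * ψ η := by
      rw [← integral_add_right_eq_self _ v.fst, SchwartzMap.fourierInv_coe, Real.fourierInv_eq',
        ← integral_const_mul]
      refine integral_congr_ae (Filter.Eventually.of_forall fun t => ?_)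
      simp only [add_sub_cancel_right, inner_add_left, smul_eq_mul, ← mul_assoc, ← exp_add]
      congr 2
      push_cast
      ring
    rw [h5, RCLike.norm_conj, h6, norm_mul, norm_exp_ofReal_mul_I, one_mul]
  change ‖∫ t, φ t * g t‖ ≤ _
  rw [h2]
  refine (norm_integral_le_integral_norm _).trans_eq ?_
  simp_rw [norm_mul, h4]

/-- The overlap `⟨φ, π(v) φ⟩` of a Schwartz function with its time-frequency shifts decreases
rapidly in `v`: in position directly, in frequency after a Fourier transform. -/
lemma exists_overlap_decay (φ : 𝓢(Conf d, ℂ)) (N : ℕ) :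
    ∃ C : ℝ, 0 < C ∧ ∀ v : Phase d,
      (1 + ‖v‖) ^ N * ‖∫ t, φ t * conj (tfShift v φ t)‖ ≤ C := by
  obtain ⟨C₁, hC₁, h₁⟩ := exists_correlation_decay φ φ N
  obtain ⟨C₂, hC₂, h₂⟩ := exists_correlation_decay (𝓕⁻ φ) (𝓕⁻ φ) N
  refine ⟨2 ^ N * (C₁ + (2 * Real.pi) ^ N * C₂), by positivity, fun v => ?_⟩
  set O := ‖∫ t, φ t * conj (tfShift v φ t)‖
  have hO : 0 ≤ O := norm_nonneg _
  have hx : (1 + ‖v.fst‖) ^ N * O ≤ C₁ := by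
    refine le_trans ?_ (h₁ (-v.fst))
    rw [norm_neg]
    gcongr
    refine (norm_integral_le_integral_norm _).trans_eq ?_
    refine integral_congr_ae (Filter.Eventually.of_forall fun t => ?_)
    simp only [norm_mul, RCLike.norm_conj, norm_tfShift, sub_eq_add_neg]
  have hω : (1 + ‖v.snd‖) ^ N * O ≤ (2 * Real.pi) ^ N * C₂ := by
    have h3 : 1 + ‖v.snd‖ ≤ 2 * Real.pi * (1 + ‖(2 * Real.pi)⁻¹ • v.snd‖) := by
      rw [norm_smul, Real.norm_of_nonneg (by positivity), mul_add,
        mul_inv_cancel_left₀ (by positivity)]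
      linarith [Real.pi_gt_three]
    calc (1 + ‖v.snd‖) ^ N * O
        ≤ (2 * Real.pi * (1 + ‖(2 * Real.pi)⁻¹ • v.snd‖)) ^ N * O := by gcongr
      _ = (2 * Real.pi) ^ N * ((1 + ‖(2 * Real.pi)⁻¹ • v.snd‖) ^ N * O) := by
          rw [mul_pow, mul_assoc]
      _ ≤ (2 * Real.pi) ^ N * C₂ := by
          gcongr
          refine le_trans ?_ (h₂ ((2 * Real.pi)⁻¹ • v.snd))
          gcongr
          exact norm_overlap_le_fourier φ v
  have hv : ‖v‖ ≤ ‖v.fst‖ + ‖v.snd‖ := by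
    rw [WithLp.prod_norm_eq_of_L2]
    refine Real.sqrt_le_iff.2 ⟨by positivity, ?_⟩
    nlinarith [norm_nonneg v.fst, norm_nonneg v.snd]
  have key : ∀ s : ℝ, 0 ≤ s → ‖v‖ ≤ 2 * s → (1 + ‖v‖) ^ N * O ≤ 2 ^ N * ((1 + s) ^ N * O) := by
    intro s hs hle
    rw [← mul_assoc, ← mul_pow]
    gcongr
    linarith
  have hC₂' : 0 < (2 * Real.pi) ^ N * C₂ := by positivity
  rcases le_total ‖v.fst‖ ‖v.snd‖ with hle | hle
  · refine (key _ (norm_nonneg v.snd) (by linarith)).trans ?_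
    gcongr
    linarith
  · refine (key _ (norm_nonneg v.fst) (by linarith)).trans ?_
    gcongr
    linarith

/-- Small time-frequency shifts of a Schwartz window are close to it in `L²`, by dominated
convergence. -/
lemma exists_lintegral_tfShift_sub_le (φ : 𝓢(Conf d, ℂ)) {ε : ℝ} (hε : 0 < ε) :
    ∃ δ : ℝ, 0 < δ ∧ ∀ v : Phase d, ‖v‖ < δ →
      ∫⁻ t, ‖tfShift v φ t - φ t‖ₑ ^ 2 ≤ ENNReal.ofReal ε := by
  obtain ⟨P, hP0, hP⟩ := exists_schwartz_decay φ (d + 1)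
  set m : ℕ := d + 1
  set B : ℝ := 2 ^ m * P + P
  have hB : 0 < B := by positivity
  have hbound : ∀ v : Phase d, ‖v‖ < 1 → ∀ t, ‖tfShift v φ t - φ t‖ₑ ^ 2 ≤
      ENNReal.ofReal (B ^ 2) * ENNReal.ofReal ((1 + ‖t‖) ^ (-(m : ℝ))) := by
    intro v hv t
    have h1 : ‖v.fst‖ ≤ 1 := (WithLp.norm_fst_le _ v).trans hv.le
    have hpos : 0 < (1 + ‖t‖) ^ m := by positivity
    have h2 : 1 + ‖t‖ ≤ 2 * (1 + ‖t - v.fst‖) := by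
      have h3 := one_add_norm_le_mul (t - v.fst) v.fst
      rw [sub_add_cancel] at h3
      nlinarith [norm_nonneg (t - v.fst)]
    have h4 : (1 + ‖t‖) ^ m * ‖tfShift v φ t - φ t‖ ≤ B := by
      calc (1 + ‖t‖) ^ m * ‖tfShift v φ t - φ t‖
          ≤ (1 + ‖t‖) ^ m * (‖φ (t - v.fst)‖ + ‖φ t‖) := by
            gcongr
            rw [← norm_tfShift v φ t]
            exact norm_sub_le _ _
        _ = (1 + ‖t‖) ^ m * ‖φ (t - v.fst)‖ + (1 + ‖t‖) ^ m * ‖φ t‖ := mul_add _ _ _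
        _ ≤ 2 ^ m * ((1 + ‖t - v.fst‖) ^ m * ‖φ (t - v.fst)‖) + P := by
            refine add_le_add ?_ (hP t)
            rw [← mul_assoc, ← mul_pow]
            gcongr
        _ ≤ B := by
            exact add_le_add_left (mul_le_mul_of_nonneg_left (hP (t - v.fst)) (by positivity)) P
    have h5 : ‖tfShift v φ t - φ t‖ ^ 2 ≤ B ^ 2 * ((1 + ‖t‖) ^ m)⁻¹ := by
      rw [← div_eq_mul_inv, le_div_iff₀ hpos]
      have h6 : 1 ≤ (1 + ‖t‖) ^ m := one_le_pow₀ (by linarith [norm_nonneg t])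
      calc ‖tfShift v φ t - φ t‖ ^ 2 * (1 + ‖t‖) ^ m
          ≤ ‖tfShift v φ t - φ t‖ ^ 2 * ((1 + ‖t‖) ^ m * (1 + ‖t‖) ^ m) := by
            gcongr
            nlinarith
        _ = ((1 + ‖t‖) ^ m * ‖tfShift v φ t - φ t‖) ^ 2 := by ring
        _ ≤ B ^ 2 := by gcongr
    rw [Real.rpow_neg (by positivity), Real.rpow_natCast, ← ENNReal.ofReal_mul (by positivity),
      ← ofReal_norm, ← ENNReal.ofReal_pow (norm_nonneg _)]
    exact ENNReal.ofReal_le_ofReal h5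
  have hfin : ∫⁻ t : Conf d,
      ENNReal.ofReal (B ^ 2) * ENNReal.ofReal ((1 + ‖t‖) ^ (-(m : ℝ))) ≠ ∞ := by
    rw [lintegral_const_mul' _ _ ENNReal.ofReal_ne_top]
    refine ENNReal.mul_ne_top ENNReal.ofReal_ne_top (finite_integral_one_add_norm ?_).ne
    rw [finrank_euclideanSpace_fin]
    exact_mod_cast Nat.lt_succ_self d
  have hmeas : ∀ᶠ v : Phase d in nhds 0, Measurable fun t => ‖tfShift v φ t - φ t‖ₑ ^ 2 :=
    Filter.Eventually.of_forall fun v =>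
      ((continuous_tfShift_right φ.continuous v).sub φ.continuous).measurable.enorm.pow_const 2
  have hdom : ∀ᶠ v : Phase d in nhds 0, ∀ᵐ t : Conf d, ‖tfShift v φ t - φ t‖ₑ ^ 2 ≤
      ENNReal.ofReal (B ^ 2) * ENNReal.ofReal ((1 + ‖t‖) ^ (-(m : ℝ))) := by
    filter_upwards [Metric.ball_mem_nhds (0 : Phase d) one_pos] with v hv
    exact Filter.Eventually.of_forall (hbound v (mem_ball_zero_iff.1 hv))
  have hpt : ∀ᵐ t : Conf d, Filter.Tendsto (fun v : Phase d => ‖tfShift v φ t - φ t‖ₑ ^ 2)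
      (nhds 0) (nhds 0) := by
    refine Filter.Eventually.of_forall fun t => ?_
    have hφ := φ.continuous
    have h7 : Continuous fun v : Phase d => tfShift v φ t - φ t := by
      unfold tfShift
      fun_prop
    have h8 := ((ENNReal.continuous_pow 2).comp h7.enorm).tendsto 0
    have h9 : tfShift (0 : Phase d) φ t - φ t = 0 := by simp [tfShift]
    simpa only [Function.comp_def, h9, enorm_zero, ne_eq, OfNat.ofNat_ne_zero, not_false_eq_true,
      zero_pow] using h8
  have hlim := tendsto_lintegral_filter_of_dominated_convergence _ hmeas hdom hfin hpt
  rw [lintegral_zero] at hlim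
  have hev := hlim.eventually (gt_mem_nhds (ENNReal.ofReal_pos.2 hε))
  obtain ⟨δ, hδ, hδ'⟩ := Metric.eventually_nhds_iff.1 hev
  exact ⟨δ, hδ, fun v hv => (hδ' (by simpa using hv)).le⟩

/-! ### Concentration of the transform on thick sets -/

lemma ofReal_sq_le_two_mul {a b c : ℝ} (h : |a - b| ≤ c) :
    ENNReal.ofReal (a ^ 2) ≤ 2 * ENNReal.ofReal (b ^ 2) + 2 * ENNReal.ofReal (c ^ 2) := by
  rw [show (2 : ℝ≥0∞) = ENNReal.ofReal 2 by simp, ← ENNReal.ofReal_mul two_pos.le,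
    ← ENNReal.ofReal_mul two_pos.le, ← ENNReal.ofReal_add (by positivity) (by positivity)]
  refine ENNReal.ofReal_le_ofReal ?_
  have h1 := sq_le_sq' (neg_le_of_abs_le h) (le_of_abs_le h)
  nlinarith [sq_nonneg (a - 2 * b)]

/-- Moving the base point changes the modulus of the transform by no more than the modulus of the
transform with the difference of the shifted and the original window. The transform itself has no
such property, because of the phase in `windowTransform_add`. -/
lemma enorm_sq_transform_le (φ : 𝓢(Conf d, ℂ)) {h : ℝ} (hh : 0 < h) (f : L2 d) (z u : Phase d) :
    ‖transform φ h f z‖ₑ ^ 2 ≤ 2 * ‖transform φ h f (z + u)‖ₑ ^ 2 +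
      2 * ‖windowTransform (fun t => tfShift (h ^ (-(1 / 2) : ℝ) • u) φ t - φ t) h f z‖ₑ ^ 2 := by
  set v := h ^ (-(1 / 2) : ℝ) • u
  have hsub : windowTransform (fun t => tfShift v φ t - φ t) h f z =
      windowTransform (tfShift v φ) h f z - windowTransform φ h f z := by
    rw [windowTransform, windowTransform, windowTransform,
      ← integral_sub (integrable_windowTransform (continuous_tfShift_right φ.continuous v)
        (memLp_tfShift φ.continuous (φ.memLp 2 volume) v) hh (Lp.memLp f) z)
        (integrable_windowTransform φ.continuous (φ.memLp 2 volume) hh (Lp.memLp f) z)]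
    refine integral_congr_ae (Filter.Eventually.of_forall fun y => ?_)
    simp only [window, map_mul, map_sub]
    ring
  have hadd : ‖transform φ h f (z + u)‖ = ‖windowTransform (tfShift v φ) h f z‖ :=
    norm_windowTransform_add φ hh f z u
  rw [← ofReal_norm, ← ofReal_norm, ← ofReal_norm, ← ENNReal.ofReal_pow (norm_nonneg _),
    ← ENNReal.ofReal_pow (norm_nonneg _), ← ENNReal.ofReal_pow (norm_nonneg _)]
  refine ofReal_sq_le_two_mul ?_
  rw [hadd, hsub, ← windowTransform_coe, abs_sub_comm]
  exact abs_norm_sub_norm_le _ _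

lemma lintegral_enorm_sq_transform (φ : 𝓢(Conf d, ℂ)) {h : ℝ} (hh : 0 < h) (f : L2 d) :
    ∫⁻ z, ‖transform φ h f z‖ₑ ^ 2 = ENNReal.ofReal ((2 * Real.pi * h) ^ d) *
      ((∫⁻ y, ‖f y‖ₑ ^ 2) * ∫⁻ t, ‖φ t‖ₑ ^ 2) := by
  obtain ⟨M, -, hM⟩ := exists_schwartz_decay φ 0
  refine lintegral_enorm_sq_windowTransform φ.continuous (φ.memLp 2 volume) (M := M) (fun t => ?_)
    hh (Lp.stronglyMeasurable f) (Lp.memLp f)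
  simpa using hM t

lemma lintegral_enorm_sq_lt_top {Ω : Type*} [MeasurableSpace Ω] {μ : Measure Ω} {f : Ω → ℂ}
    (hf : MemLp f 2 μ) : ∫⁻ x, ‖f x‖ₑ ^ 2 ∂μ < ∞ := by
  rw [← eLpNorm_two_sq]
  exact ENNReal.pow_lt_top hf.2

/-- A set that occupies a fixed proportion of every ball of a small radius `r ≲ h^{1/2}` carries a
fixed proportion of the mass of every transform, since the modulus of the transform is almost
constant at that scale. -/
theorem exists_concentration (φ : 𝓢(Conf d, ℂ)) (hφ : ∫⁻ t, ‖φ t‖ₑ ^ 2 = 1) {α : ℝ} (hα : 0 < α) :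
    ∃ δ : ℝ, 0 < δ ∧ ∀ (h : ℝ), 0 < h → ∀ r : ℝ, 0 < r → r ≤ δ * h ^ (1 / 2 : ℝ) →
      ∀ S : Set (Phase d), MeasurableSet S →
      (∀ z, ENNReal.ofReal α * volume (ball z r) ≤ volume (ball z r ∩ S)) → ∀ f : L2 d,
      ENNReal.ofReal (α / 4 * (2 * Real.pi * h) ^ d) * (∫⁻ y, ‖f y‖ₑ ^ 2) ≤
        ∫⁻ z in S, ‖transform φ h f z‖ₑ ^ 2 := by
  -- the error `2 * (α / 4)` in the averaging argument is half of the proportion `α`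
  obtain ⟨δ, hδ, hshift⟩ := exists_lintegral_tfShift_sub_le φ (ε := α / 4) (by positivity)
  refine ⟨δ, hδ, fun h hh r hr hrδ S hS hthick f => ?_⟩
  set F : Phase d → ℝ≥0∞ := fun z => ‖transform φ h f z‖ₑ ^ 2
  have hF : Measurable F := (stronglyMeasurable_transform φ h f).measurable.enorm.pow_const 2
  set X := ∫⁻ z, F z
  set Y := ∫⁻ y, ‖f y‖ₑ ^ 2
  set Z := ∫⁻ z in S, F z
  set W : ℝ≥0∞ := volume (ball (0 : Phase d) r)
  have hW0 : W ≠ 0 := (measure_ball_pos _ _ hr).ne'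
  have hWtop : W ≠ ∞ := measure_ball_lt_top.ne
  have hXY : X = ENNReal.ofReal ((2 * Real.pi * h) ^ d) * Y := by
    rw [show X = _ from lintegral_enorm_sq_transform φ hh f, hφ, mul_one]
  have hYtop : Y ≠ ∞ := (lintegral_enorm_sq_lt_top (Lp.memLp f)).ne
  have hXtop : X ≠ ∞ := by rw [hXY]; exact ENNReal.mul_ne_top ENNReal.ofReal_ne_top hYtop
  have hdiff : ∀ u ∈ ball (0 : Phase d) r, ∫⁻ z,
      ‖windowTransform (fun t => tfShift (h ^ (-(1 / 2) : ℝ) • u) φ t - φ t) h f z‖ₑ ^ 2 ≤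
        ENNReal.ofReal (α / 4) * X := by
    intro u hu
    set v := h ^ (-(1 / 2) : ℝ) • u
    have hv : ‖v‖ < δ := by
      have h1 : 0 < h ^ (-(1 / 2) : ℝ) := Real.rpow_pos_of_pos hh _
      rw [norm_smul, Real.norm_of_nonneg h1.le]
      calc h ^ (-(1 / 2) : ℝ) * ‖u‖ < h ^ (-(1 / 2) : ℝ) * (δ * h ^ (1 / 2 : ℝ)) := by
            gcongr
            exact (mem_ball_zero_iff.1 hu).trans_le hrδ
        _ = δ * (h ^ (-(1 / 2) : ℝ) * h ^ (1 / 2 : ℝ)) := by ring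
        _ = δ := by rw [← Real.rpow_add hh]; norm_num
    obtain ⟨M, -, hM⟩ := exists_schwartz_decay φ 0
    have hM' : ∀ t, ‖φ t‖ ≤ M := fun t => by simpa using hM t
    have hb : ∀ t, ‖tfShift v φ t - φ t‖ ≤ M + M := fun t =>
      (norm_sub_le _ _).trans (add_le_add ((norm_tfShift v φ t).trans_le (hM' _)) (hM' t))
    refine (lintegral_enorm_sq_windowTransform (ψ := fun t => tfShift v φ t - φ t)
      ((continuous_tfShift_right φ.continuous v).sub φ.continuous)
      ((memLp_tfShift φ.continuous (φ.memLp 2 volume) v).sub (φ.memLp 2 volume)) hb hh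
      (Lp.stronglyMeasurable f) (Lp.memLp f)).trans_le ?_
    calc ENNReal.ofReal ((2 * Real.pi * h) ^ d) * (Y * ∫⁻ t, ‖tfShift v φ t - φ t‖ₑ ^ 2)
        ≤ ENNReal.ofReal ((2 * Real.pi * h) ^ d) * (Y * ENNReal.ofReal (α / 4)) := by
          gcongr
          exact hshift v hv
      _ = ENNReal.ofReal (α / 4) * X := by
          rw [hXY]
          ring
  -- average over the displacement `u` in a ball, and compare `F z` with `F (z + u)`
  have hmain : ENNReal.ofReal α * X * W ≤ (2 * Z + 2 * (ENNReal.ofReal (α / 4) * X)) * W := by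
    have hind : Measurable (S.indicator (1 : Phase d → ℝ≥0∞)) := measurable_one.indicator hS
    have h1 : ∀ z, ENNReal.ofReal α * W ≤
        ∫⁻ u in ball (0 : Phase d) r, S.indicator (1 : Phase d → ℝ≥0∞) (z + u) := by
      intro z
      have h2 : volume (ball z r) = W := Measure.addHaar_ball_center _ _ _
      rw [← h2]
      refine (hthick z).trans_eq ?_
      rw [← lintegral_indicator_one (measurableSet_ball.inter hS),
        ← lintegral_add_left_eq_self _ z, ← lintegral_indicator measurableSet_ball]
      refine lintegral_congr fun u => ?_
      by_cases hu : u ∈ ball (0 : Phase d) r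
      · have hu' : z + u ∈ ball z r := by simpa [mem_ball_iff_norm] using hu
        rw [Set.indicator_of_mem hu]
        by_cases hs : z + u ∈ S
        · rw [Set.indicator_of_mem hs, Set.indicator_of_mem (Set.mem_inter hu' hs)]
        · rw [Set.indicator_of_notMem hs, Set.indicator_of_notMem fun h => hs h.2]
      · have hu' : z + u ∉ ball z r := by simpa [mem_ball_iff_norm] using hu
        rw [Set.indicator_of_notMem hu, Set.indicator_of_notMem fun h => hu' h.1]
    have hmeas2 : Measurable fun p : Phase d × Phase d =>
        F p.1 * S.indicator (1 : Phase d → ℝ≥0∞) (p.1 + p.2) :=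
      (hF.comp measurable_fst).mul (hind.comp (measurable_fst.add measurable_snd))
    calc ENNReal.ofReal α * X * W = ∫⁻ z, F z * (ENNReal.ofReal α * W) := by
          rw [lintegral_mul_const _ hF]
          ring
      _ ≤ ∫⁻ z, F z * ∫⁻ u in ball (0 : Phase d) r,
            S.indicator (1 : Phase d → ℝ≥0∞) (z + u) := by
          gcongr with z
          exact h1 z
      _ = ∫⁻ z, ∫⁻ u in ball (0 : Phase d) r,
            F z * S.indicator (1 : Phase d → ℝ≥0∞) (z + u) := by
          refine lintegral_congr fun z => ?_
          rw [lintegral_const_mul' _ _ (ENNReal.pow_ne_top enorm_ne_top)]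
      _ = ∫⁻ u in ball (0 : Phase d) r, ∫⁻ z,
            F z * S.indicator (1 : Phase d → ℝ≥0∞) (z + u) :=
          lintegral_lintegral_swap hmeas2.aemeasurable
      _ ≤ ∫⁻ u in ball (0 : Phase d) r, (2 * Z + 2 * (ENNReal.ofReal (α / 4) * X)) := by
          refine setLIntegral_mono measurable_const fun u hu => ?_
          have h3 : ∀ z, F z * S.indicator (1 : Phase d → ℝ≥0∞) (z + u) ≤
              2 * S.indicator F (z + u) + 2 *
              ‖windowTransform (fun t => tfShift (h ^ (-(1 / 2) : ℝ) • u) φ t - φ t) h f z‖ₑ ^ 2 := by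
            intro z
            by_cases hs : z + u ∈ S
            · rw [Set.indicator_of_mem hs, Set.indicator_of_mem hs, Pi.one_apply, mul_one]
              exact enorm_sq_transform_le φ hh f z u
            · rw [Set.indicator_of_notMem hs, mul_zero]
              exact zero_le
          have hFS : Measurable fun z => 2 * S.indicator F (z + u) :=
            ((hF.indicator hS).comp (measurable_add_const u)).const_mul 2
          refine (lintegral_mono h3).trans ?_
          rw [lintegral_add_left hFS, lintegral_const_mul' _ _ ENNReal.ofNat_ne_top,
            lintegral_const_mul' _ _ ENNReal.ofNat_ne_top, lintegral_add_right_eq_self,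
            lintegral_indicator hS]
          gcongr
          exact hdiff u hu
      _ = (2 * Z + 2 * (ENNReal.ofReal (α / 4) * X)) * W := by
          rw [setLIntegral_const]
  have hmain2 := (ENNReal.mul_le_mul_iff_left hW0 hWtop).1 hmain
  rw [ENNReal.ofReal_mul (by positivity), mul_assoc, ← hXY]
  by_cases hZ : Z = ∞
  · rw [hZ]; exact le_top
  have h4 : (α / 4) * X.toReal ≤ Z.toReal := by
    have h5 := ENNReal.toReal_mono (by finiteness) hmain2
    rw [ENNReal.toReal_add (by finiteness) (by finiteness), ENNReal.toReal_mul,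
      ENNReal.toReal_mul, ENNReal.toReal_mul, ENNReal.toReal_mul,
      ENNReal.toReal_ofReal hα.le, ENNReal.toReal_ofReal (by positivity),
      ENNReal.toReal_ofNat] at h5
    linarith
  rw [← ENNReal.toReal_le_toReal (by finiteness) hZ, ENNReal.toReal_mul,
    ENNReal.toReal_ofReal (by positivity)]
  exact h4

/-! ### The form as a closed operator into a weighted `L²` space -/

lemma transform_eq_inner (φ : 𝓢(Conf d, ℂ)) {h : ℝ} (hh : 0 < h) (f : L2 d) (z : Phase d) :
    transform φ h f z = inner ℂ ((memLp_coherentState φ hh z).toLp (coherentState φ h z)) f := by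
  rw [L2.inner_def, transform]
  refine integral_congr_ae ?_
  filter_upwards [(memLp_coherentState φ hh z).coeFn_toLp] with y hy
  rw [hy]
  rfl

lemma continuous_transform_apply (φ : 𝓢(Conf d, ℂ)) {h : ℝ} (hh : 0 < h) (z : Phase d) :
    Continuous fun f : L2 d => transform φ h f z := by
  simp_rw [transform_eq_inner φ hh]
  fun_prop

lemma memLp_transform {φ : 𝓢(Conf d, ℂ)} {a : Phase d → ℝ} {h : ℝ} (hh : 0 < h) {f : L2 d}
    (hf : f ∈ formDomain φ a hh) : MemLp (transform φ h f) 2 (symbolMeasure a) := hf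

/-- The square root of the form: the transform, normalized by `(2πh)^{-d/2}`, as an operator from
`L²(ℝ^d)` into `L²(a dx dω)` with domain `D_{a,h}`. -/
noncomputable def formRoot (φ : 𝓢(Conf d, ℂ)) (a : Phase d → ℝ) {h : ℝ} (hh : 0 < h) :
    L2 d →ₗ.[ℂ] Lp ℂ 2 (symbolMeasure a) where
  domain := formDomain φ a hh
  toFun :=
    { toFun := fun f => ((√((2 * Real.pi * h) ^ d)⁻¹ : ℝ) : ℂ) •
        (memLp_transform hh f.2).toLp (transform φ h (f : L2 d))
      map_add' := fun f g => by
        rw [← smul_add, ← MemLp.toLp_add]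
        congr 1
        exact MemLp.toLp_congr _ _ (by rw [Submodule.coe_add, transform_add φ hh])
      map_smul' := fun c f => by
        have hsmul : (memLp_transform hh (c • f).2).toLp
            (transform φ h ((c • f : formDomain φ a hh) : L2 d)) =
              c • (memLp_transform hh f.2).toLp (transform φ h (f : L2 d)) := by
          rw [← MemLp.toLp_const_smul]
          exact MemLp.toLp_congr _ _ (by rw [Submodule.coe_smul, transform_smul])
        rw [hsmul, smul_comm, RingHom.id_apply] }

variable {φ : 𝓢(Conf d, ℂ)} {a : Phase d → ℝ} {h : ℝ}

lemma formRoot_apply (hh : 0 < h) (f : (formRoot φ a hh).domain) :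
    formRoot φ a hh f = ((√((2 * Real.pi * h) ^ d)⁻¹ : ℝ) : ℂ) •
      (memLp_transform hh f.2).toLp (transform φ h (f : L2 d)) := rfl

lemma inner_formRoot (hh : 0 < h) (f g : (formRoot φ a hh).domain) :
    inner ℂ (formRoot φ a hh g) (formRoot φ a hh f) = form φ a h (f : L2 d) (g : L2 d) := by
  have hpos : 0 ≤ ((2 * Real.pi * h) ^ d)⁻¹ := by positivity
  rw [formRoot_apply, formRoot_apply, inner_smul_left, inner_smul_right, conj_ofReal, ← mul_assoc,
    ← ofReal_mul, Real.mul_self_sqrt hpos, form, L2.inner_def]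
  congr 1
  refine integral_congr_ae ?_
  filter_upwards [(memLp_transform hh f.2).coeFn_toLp, (memLp_transform hh g.2).coeFn_toLp]
    with z hf hg
  rw [hf, hg]
  rfl

lemma lintegral_symbolMeasure (ha : AEMeasurable a volume) (F : Phase d → ℝ≥0∞) :
    ∫⁻ z, F z ∂(symbolMeasure a) = ∫⁻ z, ENNReal.ofReal (a z) * F z :=
  lintegral_withDensity_eq_lintegral_mul_non_measurable₀ _ ha.ennreal_ofReal
    (Filter.Eventually.of_forall fun _ => ENNReal.ofReal_lt_top) _

lemma ofReal_norm_formRoot_sq (ha : AEMeasurable a volume) (hh : 0 < h)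
    (f : (formRoot φ a hh).domain) :
    ENNReal.ofReal (‖formRoot φ a hh f‖ ^ 2) = ENNReal.ofReal ((2 * Real.pi * h) ^ d)⁻¹ *
      ∫⁻ z, ENNReal.ofReal (a z) * ‖transform φ h (f : L2 d) z‖ₑ ^ 2 := by
  have hpos : 0 ≤ ((2 * Real.pi * h) ^ d)⁻¹ := by positivity
  rw [formRoot_apply, norm_smul, mul_pow, norm_real, Real.norm_of_nonneg (Real.sqrt_nonneg _),
    Real.sq_sqrt hpos, ENNReal.ofReal_mul hpos, ENNReal.ofReal_pow (norm_nonneg _), ofReal_norm,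
    Lp.enorm_def, eLpNorm_congr_ae (memLp_transform hh f.2).coeFn_toLp, eLpNorm_two_sq,
    lintegral_symbolMeasure ha]

/-- The form is closed: convergence in `L²(ℝ^d)` gives pointwise convergence of the transforms,
which identifies the limit in the weighted space. -/
lemma isClosed_formRoot (hh : 0 < h) : (formRoot φ a hh).IsClosed := by
  set c : ℂ := ((√((2 * Real.pi * h) ^ d)⁻¹ : ℝ) : ℂ)
  have hc : c ≠ 0 := by
    have : 0 < √((2 * Real.pi * h) ^ d)⁻¹ := Real.sqrt_pos.2 (by positivity)
    exact ofReal_ne_zero.2 this.ne'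
  refine IsSeqClosed.isClosed fun u p hu hp => ?_
  choose f hf1 hf2 using fun n => (LinearPMap.mem_graph_iff _).1 (hu n)
  have hlim1 : Filter.Tendsto (fun n => (f n : L2 d)) Filter.atTop (nhds p.1) := by
    simp_rw [hf1]
    exact (continuous_fst.tendsto p).comp hp
  have hlim2 : Filter.Tendsto
      (fun n => (memLp_transform hh (f n).2).toLp (transform φ h (f n : L2 d))) Filter.atTop
      (nhds (c⁻¹ • p.2)) := by
    have h1 : ∀ n, (memLp_transform hh (f n).2).toLp (transform φ h (f n : L2 d)) =
        c⁻¹ • (u n).2 := by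
      intro n
      rw [← hf2 n, formRoot_apply, smul_smul, inv_mul_cancel₀ hc, one_smul]
    simp_rw [h1]
    exact ((continuous_snd.tendsto p).comp hp).const_smul _
  obtain ⟨ns, hns, hns'⟩ :=
    (tendstoInMeasure_of_tendsto_Lp hlim2).exists_seq_tendsto_ae
  have hae : (transform φ h p.1) =ᵐ[symbolMeasure a] (c⁻¹ • p.2 : Lp ℂ 2 (symbolMeasure a)) := by
    have hall := ae_all_iff.2 fun n => (memLp_transform hh (f n).2).coeFn_toLp
    filter_upwards [hns', hall] with z hz hz'
    refine tendsto_nhds_unique ?_ hz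
    simp_rw [hz']
    exact (((continuous_transform_apply φ hh z).tendsto p.1).comp hlim1).comp hns.tendsto_atTop
  have hmem : p.1 ∈ formDomain φ a hh := (memLp_congr_ae hae).2 (Lp.memLp _)
  refine (LinearPMap.mem_graph_iff _).2 ⟨⟨p.1, hmem⟩, rfl, ?_⟩
  have heq : (memLp_transform hh hmem).toLp (transform φ h p.1) = c⁻¹ • p.2 :=
    Lp.ext ((memLp_transform hh hmem).coeFn_toLp.trans hae)
  change c • (memLp_transform hh hmem).toLp (transform φ h p.1) = p.2
  rw [heq, smul_smul, mul_inv_cancel₀ hc, one_smul]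

lemma isFormOperator_operator (hh : 0 < h) (hD : Dense (formDomain φ a hh : Set (L2 d))) :
    IsFormOperator (formRoot φ a hh) (operator φ a hh) := by
  intro f u
  rw [graph_operator φ a hh hD]
  constructor
  · rintro ⟨hf, hu⟩
    exact ⟨hf, fun g => (hu g g.2).trans (inner_formRoot hh ⟨f, hf⟩ g).symm⟩
  · rintro ⟨hf, hu⟩
    exact ⟨hf, fun g hg => (hu ⟨g, hg⟩).trans (inner_formRoot hh ⟨f, hf⟩ ⟨g, hg⟩)⟩

/-! ### Coherent states as elements of the form domain -/

/-- The coherent state at `z`, as an element of `L²(ℝ^d)`. -/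
noncomputable def coherentLp (φ : 𝓢(Conf d, ℂ)) (hh : 0 < h) (z : Phase d) : L2 d :=
  (memLp_coherentState φ hh z).toLp (coherentState φ h z)

lemma norm_coherentLp (hφ : ∫⁻ t, ‖φ t‖ₑ ^ 2 = 1) (hh : 0 < h) (z : Phase d) :
    ‖coherentLp φ hh z‖ = 1 := by
  have h1 : ‖coherentLp φ hh z‖ₑ ^ 2 = 1 := by
    rw [Lp.enorm_def, coherentLp, eLpNorm_congr_ae (MemLp.coeFn_toLp _), eLpNorm_two_sq,
      ← window_coe, lintegral_enorm_sq_window φ.continuous hh, hφ]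
  rw [← ofReal_norm, ← ENNReal.ofReal_pow (norm_nonneg _), ENNReal.ofReal_eq_one] at h1
  exact (pow_eq_one_iff_of_nonneg (norm_nonneg _) two_ne_zero).1 h1

/-- The form is bounded on coherent states by the average of the symbol at the natural scale. -/
lemma exists_lintegral_coherentLp_le (φ : 𝓢(Conf d, ℂ)) {α : ℝ} (hα : α ∈ Set.Ioo (0 : ℝ) 1) :
    ∃ C : ℝ, 0 < C ∧ ∀ a : Phase d → ℝ, MuckenhouptAInf α a → ∀ (h : ℝ) (hh : 0 < h)
      (z : Phase d),
      ∫⁻ w, ENNReal.ofReal (a w) * ‖transform φ h (coherentLp φ hh z) w‖ₑ ^ 2 ≤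
        ENNReal.ofReal (C * ∫ w in ball z (h ^ (1 / 2 : ℝ)), a w) := by
  obtain ⟨N, C₁, hC₁, hprofile⟩ := exists_lintegral_profile_le (Phase d) hα
  obtain ⟨C₂, hC₂, hoverlap⟩ := exists_overlap_decay φ N
  refine ⟨C₂ ^ 2 * C₁, by positivity, fun a ha h hh z => ?_⟩
  have hs : 0 < h ^ (1 / 2 : ℝ) := Real.rpow_pos_of_pos hh _
  have hpt : ∀ w, ‖transform φ h (coherentLp φ hh z) w‖ₑ ^ 2 ≤
      ENNReal.ofReal (C₂ ^ 2) *
        ENNReal.ofReal (((1 + ‖w - z‖ / h ^ (1 / 2 : ℝ)) ^ N)⁻¹) := by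
    intro w
    have h1 : transform φ h (coherentLp φ hh z) w =
        windowTransform φ h (coherentState φ h z) w := by
      refine integral_congr_ae ?_
      filter_upwards [MemLp.coeFn_toLp (memLp_coherentState φ hh z)] with y hy
      rw [coherentLp, hy]
      rfl
    have h2 := norm_transform_coherentState φ hh z (w - z)
    rw [add_sub_cancel] at h2
    have h3 := hoverlap (h ^ (-(1 / 2) : ℝ) • (w - z))
    rw [← h2, ← h1, norm_smul, Real.norm_of_nonneg (Real.rpow_nonneg hh.le _),
      Real.rpow_neg hh.le, inv_mul_eq_div] at h3
    have hpos : 0 < (1 + ‖w - z‖ / h ^ (1 / 2 : ℝ)) ^ N := by positivity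
    have hge : 1 ≤ (1 + ‖w - z‖ / h ^ (1 / 2 : ℝ)) ^ N :=
      one_le_pow₀ (le_add_of_nonneg_right (by positivity))
    rw [← ENNReal.ofReal_mul (by positivity), ← ofReal_norm, ← ENNReal.ofReal_pow (norm_nonneg _)]
    refine ENNReal.ofReal_le_ofReal ?_
    rw [← div_eq_mul_inv, le_div_iff₀ hpos]
    set b := ‖transform φ h (coherentLp φ hh z) w‖
    set q := (1 + ‖w - z‖ / h ^ (1 / 2 : ℝ)) ^ N
    calc b ^ 2 * q ≤ b ^ 2 * (q * q) := by
          gcongr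
          nlinarith
      _ = (q * b) ^ 2 := by ring
      _ ≤ C₂ ^ 2 := by
          have : 0 ≤ b := norm_nonneg _
          gcongr
  calc ∫⁻ w, ENNReal.ofReal (a w) * ‖transform φ h (coherentLp φ hh z) w‖ₑ ^ 2
      ≤ ∫⁻ w, ENNReal.ofReal (C₂ ^ 2) * (ENNReal.ofReal (a w) *
          ENNReal.ofReal (((1 + ‖w - z‖ / h ^ (1 / 2 : ℝ)) ^ N)⁻¹)) := by
        refine lintegral_mono fun w => ?_
        refine (mul_le_mul_right (hpt w) _).trans_eq ?_
        ring
    _ ≤ ENNReal.ofReal (C₂ ^ 2) *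
          ENNReal.ofReal (C₁ * ∫ w in ball z (h ^ (1 / 2 : ℝ)), a w) := by
        rw [lintegral_const_mul' _ _ ENNReal.ofReal_ne_top]
        gcongr
        exact hprofile a ha z _ hs
    _ = ENNReal.ofReal (C₂ ^ 2 * C₁ * ∫ w in ball z (h ^ (1 / 2 : ℝ)), a w) := by
        rw [← ENNReal.ofReal_mul (by positivity), mul_assoc]

lemma coherentLp_mem_formDomain {α : ℝ} (hα : α ∈ Set.Ioo (0 : ℝ) 1) (ha : MuckenhouptAInf α a)
    (hh : 0 < h) (z : Phase d) : coherentLp φ hh z ∈ formDomain φ a hh := by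
  obtain ⟨C, -, hC⟩ := exists_lintegral_coherentLp_le φ hα
  rw [mem_formDomain_iff φ ha.locallyIntegrable.aestronglyMeasurable.aemeasurable]
  refine lt_of_le_of_lt ?_ ((hC a ha h hh z).trans_lt ENNReal.ofReal_lt_top)
  refine lintegral_mono fun w => ?_
  rw [ENNReal.ofReal_pow (norm_nonneg _), ofReal_norm]

/-- The coherent states span a dense subspace: a function orthogonal to all of them has vanishing
transform, so it is zero by the orthogonality relation. -/
lemma dense_formDomain (hφ : ∫⁻ t, ‖φ t‖ₑ ^ 2 = 1) {α : ℝ} (hα : α ∈ Set.Ioo (0 : ℝ) 1)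
    (ha : MuckenhouptAInf α a) (hh : 0 < h) : Dense (formDomain φ a hh : Set (L2 d)) := by
  rw [Submodule.dense_iff_topologicalClosure_eq_top, Submodule.topologicalClosure_eq_top_iff,
    Submodule.eq_bot_iff]
  intro f hf
  have h1 : ∀ z, transform φ h f z = 0 := fun z => by
    rw [transform_eq_inner φ hh]
    exact (Submodule.mem_orthogonal _ _).1 hf _ (coherentLp_mem_formDomain hα ha hh z)
  have h2 := lintegral_enorm_sq_transform φ hh f
  simp only [h1, enorm_zero, ne_eq, OfNat.ofNat_ne_zero, not_false_eq_true, zero_pow,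
    lintegral_zero, hφ, mul_one] at h2
  have h3 : ∫⁻ y, ‖f y‖ₑ ^ 2 = 0 := by
    refine (mul_eq_zero.1 h2.symm).resolve_left ?_
    exact (ENNReal.ofReal_pos.2 (by positivity)).ne'
  rw [← eLpNorm_two_sq, ← Lp.enorm_def] at h3
  exact enorm_eq_zero.1 (pow_eq_zero_iff two_ne_zero |>.1 h3)

/-! ### Two-sided bounds for the form -/

lemma lam_nonneg {α : ℝ} (ha : MuckenhouptAInf α a) (h : ℝ) : 0 ≤ lam a h := by
  refine Real.iInf_nonneg fun z => ?_
  rw [setAverage_eq, smul_eq_mul]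
  exact mul_nonneg (by positivity) (ha.setIntegral_nonneg _)

lemma lam_le {α : ℝ} (ha : MuckenhouptAInf α a) (h : ℝ) (z : Phase d) :
    lam a h ≤ ⨍ y in ball z (h ^ (1 / 2 : ℝ)), a y := by
  refine ciInf_le ⟨0, ?_⟩ z
  rintro _ ⟨w, rfl⟩
  simp only [setAverage_eq, smul_eq_mul]
  exact mul_nonneg (by positivity) (ha.setIntegral_nonneg _)

/-- Upper bound for the form on coherent states. The volume of a ball of radius `h^{1/2}` in the
`2d`-dimensional phase space is proportional to `h^d`, which balances the normalization. -/
lemma exists_formRoot_coherentLp_le (φ : 𝓢(Conf d, ℂ)) {α : ℝ} (hα : α ∈ Set.Ioo (0 : ℝ) 1) :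
    ∃ C : ℝ, 0 < C ∧ ∀ a : Phase d → ℝ, MuckenhouptAInf α a → ∀ (h : ℝ) (hh : 0 < h)
      (z : Phase d) (hz : coherentLp φ hh z ∈ (formRoot φ a hh).domain),
      ‖formRoot φ a hh ⟨coherentLp φ hh z, hz⟩‖ ^ 2 ≤
        C * ⨍ w in ball z (h ^ (1 / 2 : ℝ)), a w := by
  obtain ⟨C, hC, hle⟩ := exists_lintegral_coherentLp_le φ hα
  set v := (volume : Measure (Phase d)).real (ball 0 1)
  have hv : 0 < v := volume_real_ball_pos 0 one_pos
  refine ⟨((2 * Real.pi) ^ d)⁻¹ * v * C, by positivity, fun a ha h hh z hz => ?_⟩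
  have hs : 0 < h ^ (1 / 2 : ℝ) := Real.rpow_pos_of_pos hh _
  have h1 := ofReal_norm_formRoot_sq ha.locallyIntegrable.aestronglyMeasurable.aemeasurable hh
    ⟨coherentLp φ hh z, hz⟩
  have hI := ha.setIntegral_nonneg (ball z (h ^ (1 / 2 : ℝ)))
  have h2 : ‖formRoot φ a hh ⟨coherentLp φ hh z, hz⟩‖ ^ 2 ≤
      ((2 * Real.pi * h) ^ d)⁻¹ * (C * ∫ w in ball z (h ^ (1 / 2 : ℝ)), a w) := by
    rw [← ENNReal.ofReal_le_ofReal_iff (by positivity), h1, ENNReal.ofReal_mul (by positivity)]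
    gcongr
    exact hle a ha h hh z
  have hvol : (volume : Measure (Phase d)).real (ball z (h ^ (1 / 2 : ℝ))) = h ^ d * v := by
    have hdim : Module.finrank ℝ (Phase d) = 2 * d := by
      rw [(WithLp.linearEquiv 2 ℝ (Conf d × Conf d)).finrank_eq, Module.finrank_prod,
        finrank_euclideanSpace_fin, two_mul]
    rw [Measure.real, Measure.addHaar_ball_of_pos _ _ hs, ENNReal.toReal_mul,
      ENNReal.toReal_ofReal (by positivity), hdim, pow_mul, ← Real.rpow_natCast (_ ^ _) 2,
      ← Real.rpow_mul hh.le, show (1 / 2 : ℝ) * ((2 : ℕ) : ℝ) = 1 by norm_num, Real.rpow_one]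
    rfl
  refine h2.trans_eq ?_
  rw [setAverage_eq, smul_eq_mul, hvol, mul_pow]
  field_simp

/-- Lower bound for the form. At a scale slightly below `h^{1/2}`, the symbol is at least a multiple
of `λ(a,h)` on a fixed proportion of every ball, and transforms do not avoid such sets. -/
lemma exists_formRoot_ge (hφ : ∫⁻ t, ‖φ t‖ₑ ^ 2 = 1) {α : ℝ} (hα : α ∈ Set.Ioo (0 : ℝ) 1) :
    ∃ c : ℝ, 0 < c ∧ ∀ a : Phase d → ℝ, MuckenhouptAInf α a → ∀ (h : ℝ) (hh : 0 < h)
      (f : (formRoot φ a hh).domain),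
      c * lam a h * ‖(f : L2 d)‖ ^ 2 ≤ ‖formRoot φ a hh f‖ ^ 2 := by
  obtain ⟨δ, hδ, hconc⟩ := exists_concentration φ hφ hα.1
  obtain ⟨θ, hθ, hsmall⟩ := exists_average_ball_ge (Phase d) hα
  obtain ⟨k, hk⟩ := exists_pow_lt_of_lt_one hδ hθ.2
  have hα0 := hα.1
  refine ⟨α / 2 * α ^ k * (α / 4), by positivity, fun a ha h hh f => ?_⟩
  have hl := lam_nonneg ha h
  have hs : 0 < h ^ (1 / 2 : ℝ) := Real.rpow_pos_of_pos hh _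
  have hr : 0 < θ ^ k * h ^ (1 / 2 : ℝ) := mul_pos (pow_pos hθ.1 k) hs
  have ham : AEMeasurable a volume := ha.locallyIntegrable.aestronglyMeasurable.aemeasurable
  set m := α ^ k * lam a h
  have hm : 0 ≤ m := by positivity
  -- a measurable version of the symbol, so that the superlevel set is measurable
  set S : Set (Phase d) := {w | α / 2 * m ≤ ham.mk a w}
  have hS : MeasurableSet S := measurableSet_le measurable_const ham.measurable_mk
  have hthick : ∀ z, ENNReal.ofReal α * volume (ball z (θ ^ k * h ^ (1 / 2 : ℝ))) ≤
      volume (ball z (θ ^ k * h ^ (1 / 2 : ℝ)) ∩ S) := by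
    intro z
    have h1 : m * volume.real (ball z (θ ^ k * h ^ (1 / 2 : ℝ))) ≤
        ∫ y in ball z (θ ^ k * h ^ (1 / 2 : ℝ)), a y := by
      refine le_trans ?_ (hsmall a ha z _ hs k)
      exact mul_le_mul_of_nonneg_right
        (mul_le_mul_of_nonneg_left (lam_le ha h z) (by positivity)) measureReal_nonneg
    have h2 := ha.volume_superlevel_ge hα z hr hm h1
    have h3 : volume (ball z (θ ^ k * h ^ (1 / 2 : ℝ)) ∩ S) =
        volume (ball z (θ ^ k * h ^ (1 / 2 : ℝ)) ∩ {y | α / 2 * m ≤ a y}) := by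
      refine measure_congr ?_
      filter_upwards [ham.ae_eq_mk] with w hw
      refine propext (and_congr_right fun _ => ?_)
      change α / 2 * m ≤ ham.mk a w ↔ α / 2 * m ≤ a w
      rw [hw]
    have hfin : volume (ball z (θ ^ k * h ^ (1 / 2 : ℝ))) ≠ ∞ := measure_ball_lt_top.ne
    rw [h3, ← ofReal_measureReal hfin,
      ← ofReal_measureReal (measure_ne_top_of_subset Set.inter_subset_left hfin),
      ← ENNReal.ofReal_mul hα.1.le]
    exact ENNReal.ofReal_le_ofReal h2
  have h4 := hconc h hh _ hr (by gcongr) S hS hthick (f : L2 d)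
  have h5 : ENNReal.ofReal (α / 2 * m) * ∫⁻ z in S, ‖transform φ h (f : L2 d) z‖ₑ ^ 2 ≤
      ∫⁻ z, ENNReal.ofReal (a z) * ‖transform φ h (f : L2 d) z‖ₑ ^ 2 := by
    rw [← lintegral_const_mul' _ _ ENNReal.ofReal_ne_top, ← lintegral_indicator hS]
    refine lintegral_mono_ae ?_
    filter_upwards [ham.ae_eq_mk] with w hw
    refine Set.indicator_apply_le' (fun hwS => ?_) fun _ => zero_le
    gcongr
    rw [hw]
    exact hwS
  have h6 : ∫⁻ y, ‖(f : L2 d) y‖ₑ ^ 2 = ENNReal.ofReal (‖(f : L2 d)‖ ^ 2) := by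
    rw [← eLpNorm_two_sq, ← Lp.enorm_def, ENNReal.ofReal_pow (norm_nonneg _), ofReal_norm]
  rw [h6] at h4
  have hP : 0 < (2 * Real.pi * h) ^ d := by positivity
  rw [← ENNReal.ofReal_le_ofReal_iff (by positivity), ofReal_norm_formRoot_sq ham hh]
  calc ENNReal.ofReal (α / 2 * α ^ k * (α / 4) * lam a h * ‖(f : L2 d)‖ ^ 2)
      = ENNReal.ofReal ((2 * Real.pi * h) ^ d)⁻¹ * (ENNReal.ofReal (α / 2 * m) *
          (ENNReal.ofReal (α / 4 * (2 * Real.pi * h) ^ d) *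
            ENNReal.ofReal (‖(f : L2 d)‖ ^ 2))) := by
        rw [← ENNReal.ofReal_mul (by positivity), ← ENNReal.ofReal_mul (by positivity),
          ← ENNReal.ofReal_mul (by positivity)]
        congr 1
        simp only [m]
        field_simp
    _ ≤ ENNReal.ofReal ((2 * Real.pi * h) ^ d)⁻¹ * (ENNReal.ofReal (α / 2 * m) *
          ∫⁻ z in S, ‖transform φ h (f : L2 d) z‖ₑ ^ 2) := by gcongr
    _ ≤ _ := by gcongr

end AntiWick

theorem theorem5p1 (d : ℕ) (φ : 𝓢(AntiWick.Conf d, ℂ))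
    (hφ : eLpNorm φ 2 (volume : Measure (AntiWick.Conf d)) = 1)
    (α : ℝ) (hα : α ∈ Set.Ioo (0 : ℝ) 1) :
    ∃ C : ℝ, 0 < C ∧
      ∀ a : AntiWick.Phase d → ℝ, AntiWick.MuckenhouptAInf α a →
      ∀ (h : ℝ) (hh : 0 < h),
        Dense (AntiWick.formDomain φ a hh : Set (AntiWick.L2 d)) ∧
        IsSelfAdjoint (AntiWick.operator φ a hh) ∧
        (AntiWick.realSpectrum (AntiWick.operator φ a hh)).Nonempty ∧
        BddBelow (AntiWick.realSpectrum (AntiWick.operator φ a hh)) ∧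
        C⁻¹ * AntiWick.lam a h ≤ sInf (AntiWick.realSpectrum (AntiWick.operator φ a hh)) ∧
        sInf (AntiWick.realSpectrum (AntiWick.operator φ a hh)) ≤ C * AntiWick.lam a h := by
  have hφ' : ∫⁻ t, ‖φ t‖ₑ ^ 2 = 1 := by rw [← AntiWick.eLpNorm_two_sq, hφ, one_pow]
  obtain ⟨C₁, hC₁, hupper⟩ := AntiWick.exists_formRoot_coherentLp_le φ hα
  obtain ⟨c, hc, hlower⟩ := AntiWick.exists_formRoot_ge hφ' hα
  refine ⟨max C₁ c⁻¹, lt_max_of_lt_left hC₁, fun a ha h hh => ?_⟩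
  have hD := AntiWick.dense_formDomain hφ' hα ha hh
  have hl := AntiWick.lam_nonneg ha h
  have : Nontrivial (AntiWick.L2 d) := ⟨AntiWick.coherentLp φ hh 0, 0, fun h0 => by
    have h1 := AntiWick.norm_coherentLp hφ' hh 0
    rw [h0, norm_zero] at h1
    exact zero_ne_one h1⟩
  obtain ⟨hsa, t₀, ht₀, hmax, hmin⟩ :=
    (AntiWick.isFormOperator_operator hh hD).exists_isLeast_realSpectrum
      (AntiWick.isClosed_formRoot hh) hD
  refine ⟨hD, hsa, ht₀.nonempty, ht₀.bddBelow, ?_, ?_⟩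
  · rw [ht₀.csInf_eq]
    refine le_trans ?_ (hmax (c * AntiWick.lam a h) (by positivity) (hlower a ha h hh))
    gcongr
    exact inv_le_of_inv_le₀ hc (le_max_right _ _)
  · rw [ht₀.csInf_eq]
    have h2 : ∀ z, t₀ / C₁ ≤ ⨍ w in ball z (h ^ (1 / 2 : ℝ)), a w := by
      intro z
      have hz := AntiWick.coherentLp_mem_formDomain (φ := φ) hα ha hh z
      have h3 := hmin ⟨_, hz⟩
      rw [AntiWick.norm_coherentLp hφ' hh, one_pow, mul_one] at h3
      rw [div_le_iff₀' hC₁]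
      exact h3.trans (hupper a ha h hh z hz)
    have h4 : t₀ ≤ C₁ * AntiWick.lam a h := (div_le_iff₀' hC₁).1 (le_ciInf h2)
    exact h4.trans (mul_le_mul_of_nonneg_right (le_max_left _ _) hl)
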